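/- Let $\mathcal A=(\mathcal P,\mathcal L)$ be a Desargues affine plane in $\mathbb R^2$: $\mathcal P\subseteq\mathbb R^2$ is a set of points, $\mathcal L$ is a set of subsets of $\mathcal P$ (the lines), two distinct points lie on exactly one line, through a point off a line there is exactly one line that misses it, there are three non-collinear points, and Desargues' axiom holds (for triangles with corresponding vertices on three distinct lines that are parallel or concurrent). Assume that $\mathcal A$ has more than four points and is ordered. This means that a betweenness relation $[A,B,C]$ between distinct collinear points is given such that (i) every line is an ordered line: $[A,B,C]\Rightarrow[C,B,A]$; of three distinct points of the line exactly one lies between the other two; $[A,B,C]$ and $[B,C,D]$ imply $[A,B,D]$ and $[A,C,D]$; $[A,B,C]$ and $[C,B,D]$ with $A\ne D$ imply $[D,A,B]$ or $[A,D,B]$; (ii) every parallel projection of a line onto a line preserves or reverses the ordering. Let $\ell$ be a line of $\mathcal A$ and let $O\neq I$ be points of $\ell$. For $A,C\in\ell$ and an auxiliary point $B\notin\ell$, let $A+C$ be the point in which $\ell$ meets the parallel to $CB$ through $D$, where $D$ is the common point of the parallel to $\ell$ through $B$ and the parallel to $OB$ through $A$; and let $A*C$ be the point in which $\ell$ meets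 the parallel to $BC$ through $E$, where $E$ is the common point of $OB$ and the parallel to $IB$ through $A$. Then these constructions do not depend on $B$ and make $\ell$ a skew field $\mathbf K=(\ell,+,*)$ with zero $O$ and one $I$, the skew field constructed over the ordered line $\ell$. It is an ordered skew field with positive elements $\mathbf K_+=\{X\in\ell: X=I \text{ or } [O,X,I]\text{ or }[O,I,X]\}$ and negative elements $\mathbf K_-=\{X\in\ell:[X,O,I]\}$; that is, $\mathbf K$ is the disjoint union of $\mathbf K_-$, $\{O\}$ and $\mathbf K_+$, $\mathbf K_-=-\mathbf K_+$, and $\mathbf K_+$ is closed under $+$ and $*$. In particular, if $\mathbf K$ is finite, then it is a finite ordered skew field. -/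

import Mathlib

/-- An affine plane whose points form a subset `points` of an ambient space `X` and whose lines
are sets of points. -/
structure AffinePlane (X : Type*) where
  points : Set X
  lines : Set (Set X)
  line_subset : ∀ l ∈ lines, l ⊆ points
  /-- Two distinct points lie on exactly one line. -/
  line_through : ∀ P ∈ points, ∀ Q ∈ points, P ≠ Q → ∃! l, l ∈ lines ∧ P ∈ l ∧ Q ∈ l
  /-- Through a point off a line there is exactly one line that misses the given one. -/
  playfair : ∀ P ∈ points, ∀ l ∈ lines, P ∉ l → ∃! m, m ∈ lines ∧ P ∈ m ∧ l ∩ m = ∅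
  /-- There are three non-collinear points. -/
  noncollinear : ∃ P ∈ points, ∃ Q ∈ points, ∃ R ∈ points, ∀ l ∈ lines, ¬ (P ∈ l ∧ Q ∈ l ∧ R ∈ l)

namespace AffinePlane

variable {X : Type*}

/-- Parallel lines: equal or without a common point. -/
def Parallel (l m : Set X) : Prop := l = m ∨ l ∩ m = ∅

/-- The line `PQ` is parallel to a line through `R` and `S`. For `P ≠ Q` this says that `S` lies
on the parallel to `PQ` through `R`; for `P ≠ Q` and `R ≠ S` it says that `PQ` is parallel
to `RS`. -/
def LineParallel (𝒜 : AffinePlane X) (P Q R S : X) : Prop :=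
  ∃ l ∈ 𝒜.lines, ∃ m ∈ 𝒜.lines, P ∈ l ∧ Q ∈ l ∧ R ∈ m ∧ S ∈ m ∧ Parallel l m

/-- Desargues' axiom: two triangles `ABC` and `A'B'C'` whose corresponding vertices lie on three
distinct lines `k`, `l`, `m`, which are parallel or pass through one point `V` that is none of
the vertices, and which satisfy `AB ∥ A'B'` and `BC ∥ B'C'`, also satisfy `AC ∥ A'C'`. -/
def IsDesargues (𝒜 : AffinePlane X) : Prop :=
  ∀ k ∈ 𝒜.lines, ∀ l ∈ 𝒜.lines, ∀ m ∈ 𝒜.lines, k ≠ l → l ≠ m → k ≠ m →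
    ∀ A ∈ k, ∀ A' ∈ k, ∀ B ∈ l, ∀ B' ∈ l, ∀ C ∈ m, ∀ C' ∈ m,
      ((Parallel k l ∧ Parallel l m ∧ Parallel k m) ∨
        ∃ V, V ∈ k ∧ V ∈ l ∧ V ∈ m ∧
          A ≠ V ∧ A' ≠ V ∧ B ≠ V ∧ B' ≠ V ∧ C ≠ V ∧ C' ≠ V) →
      𝒜.LineParallel A B A' B' → 𝒜.LineParallel B C B' C' → 𝒜.LineParallel A C A' C'

/-- The betweenness relation `btw A B C` (`B` lies between `A` and `C`) makes `l` an ordered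
line. As usual, betweenness is a relation between three distinct points. -/
structure IsOrderedLine (btw : X → X → X → Prop) (l : Set X) : Prop where
  distinct : ∀ A ∈ l, ∀ B ∈ l, ∀ C ∈ l, btw A B C → A ≠ B ∧ B ≠ C ∧ A ≠ C
  symm : ∀ A ∈ l, ∀ B ∈ l, ∀ C ∈ l, btw A B C → btw C B A
  /-- Of three distinct points exactly one lies between the two others. -/
  exactly_one : ∀ A ∈ l, ∀ B ∈ l, ∀ C ∈ l, A ≠ B → B ≠ C → A ≠ C →
    (btw A B C ∧ ¬ btw B C A ∧ ¬ btw C A B) ∨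
    (¬ btw A B C ∧ btw B C A ∧ ¬ btw C A B) ∨
    (¬ btw A B C ∧ ¬ btw B C A ∧ btw C A B)
  extend : ∀ A ∈ l, ∀ B ∈ l, ∀ C ∈ l, ∀ D ∈ l,
    btw A B C → btw B C D → btw A B D ∧ btw A C D
  same_side : ∀ A ∈ l, ∀ B ∈ l, ∀ C ∈ l, ∀ D ∈ l, A ≠ D →
    btw A B C → btw C B D → btw D A B ∨ btw A D B

/-- On the points of `l₁`, the map `f` is the parallel projection from `l₁` to `l₂` in the
direction of some line `d` that is parallel neither to `l₁` nor to `l₂`. -/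
def IsParallelProjection (𝒜 : AffinePlane X) (l₁ l₂ : Set X) (f : X → X) : Prop :=
  ∃ d ∈ 𝒜.lines, ¬ Parallel d l₁ ∧ ¬ Parallel d l₂ ∧
    ∀ A ∈ l₁, f A ∈ l₂ ∧ ∃ m ∈ 𝒜.lines, A ∈ m ∧ f A ∈ m ∧ Parallel d m

/-- An ordered plane: all lines are ordered lines, and every parallel projection of a line to a
line preserves or reverses the ordering. -/
structure IsOrdered (𝒜 : AffinePlane X) (btw : X → X → X → Prop) : Prop where
  line : ∀ l ∈ 𝒜.lines, IsOrderedLine btw l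
  projection : ∀ l₁ ∈ 𝒜.lines, ∀ l₂ ∈ 𝒜.lines, ∀ f, 𝒜.IsParallelProjection l₁ l₂ f →
    (∀ A ∈ l₁, ∀ B ∈ l₁, ∀ C ∈ l₁, btw A B C → btw (f A) (f B) (f C)) ∨
    (∀ A ∈ l₁, ∀ B ∈ l₁, ∀ C ∈ l₁, btw A B C → btw (f C) (f B) (f A))

/-- The construction of the sum of the points `A`, `C` of the line `OI` with auxiliary point `B`
off that line ends in `E`: `D` is the common point of the parallel to `OI` through `B` and the
parallel to `OB` through `A`, and `E` is the common point of `OI` and the parallel to `CB`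
through `D`. -/
def IsSum (𝒜 : AffinePlane X) (l : Set X) (O I B A C E : X) : Prop :=
  ∃ D, 𝒜.LineParallel O I B D ∧ 𝒜.LineParallel O B A D ∧ 𝒜.LineParallel C B D E ∧ E ∈ l

/-- The construction of the product of the points `A`, `C` of the line `OI` with auxiliary point
`B` off that line ends in `F`: `E` is the common point of `OB` and the parallel to `IB` through
`A`, and `F` is the common point of `OI` and the parallel to `BC` through `E`. -/
def IsProduct (𝒜 : AffinePlane X) (l : Set X) (O I B A C F : X) : Prop :=
  ∃ E, 𝒜.LineParallel I B A E ∧ (∃ n ∈ 𝒜.lines, O ∈ n ∧ B ∈ n ∧ E ∈ n) ∧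
    𝒜.LineParallel B C E F ∧ F ∈ l

/-- `K` is the skew field constructed over the line `l` with zero `O` and one `I`: its elements
are the points of `l`, and its sums and products are obtained by the two constructions above,
with any auxiliary point `B` off `l`. -/
structure IsConstructedSkewField (𝒜 : AffinePlane X) {l : Set X} (O I : l)
    (K : DivisionRing l) : Prop where
  zero_eq : K.zero = O
  one_eq : K.one = I
  add_eq : ∀ A C : l, ∀ B ∈ 𝒜.points, B ∉ l → 𝒜.IsSum l O I B A C (K.add A C : l)
  mul_eq : ∀ A C : l, ∀ B ∈ 𝒜.points, B ∉ l → 𝒜.IsProduct l O I B A C (K.mul A C : l)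

/-- The points of the line `OI` on the same side of `O` as `I` (including `I`). -/
def posSide (btw : X → X → X → Prop) {l : Set X} (O I : l) : Set l :=
  {x | x = I ∨ btw (O : X) x I ∨ btw (O : X) I x}

/-- The points of the line `OI` on the side of `O` opposite to `I`. -/
def negSide (btw : X → X → X → Prop) {l : Set X} (O I : l) : Set l :=
  {x | btw (x : X) O I}

end AffinePlane

/-- The skew field `K` is ordered, with set of negative elements `neg` and set of positive
elements `pos`. -/
structure IsOrderedSkewField {K : Type*} (inst : DivisionRing K) (neg pos : Set K) : Prop where
  union_eq : neg ∪ {0} ∪ pos = Set.univ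
  zero_notMem_neg : (0 : K) ∉ neg
  zero_notMem_pos : (0 : K) ∉ pos
  disjoint : Disjoint neg pos
  mem_neg_iff : ∀ k : K, k ∈ neg ↔ -k ∈ pos
  add_mem : ∀ k₁ ∈ pos, ∀ k₂ ∈ pos, k₁ + k₂ ∈ pos
  mul_mem : ∀ k₁ ∈ pos, ∀ k₂ ∈ pos, k₁ * k₂ ∈ pos

/-- A finite ordered skew field. -/
def IsFiniteOrderedSkewField {K : Type*} (inst : DivisionRing K) (neg pos : Set K) : Prop :=
  Finite K ∧ IsOrderedSkewField inst neg pos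

/-! The points of `l` stand for maps of the whole plane. A point `A` of `l` corresponds to the
translation taking `O` to `A` and to the dilatation fixing `O` and taking `I` to `A`; the two
constructions draw the images of `C` under these maps, so that `A + C` and `A * C` are the values at
`C`. Desargues' axiom supplies the maps (`IsPencil.exists_map` treats its parallel and its central
form at once), and `IsDilatation.ext` makes them unique. Associativity and left distributivity then
become identities between composites (`exists_coordinateField`). The maps do not involve the
auxiliary point `B`, whence the independence of `B` (`isConstructedSkewField_iff`).

For the order, both `C ↦ A + C` and `A ↦ A * D` with `D ≠ 0` are composites of two parallel
projections, so they preserve betweenness (`btw_add`, `btw_mul`). The rest is algebra on one line: a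
betweenness relation invariant under these maps makes the side of `I` a set of positive elements
(`IsOrderedLine.isOrderedSkewField`). More than four points ensure three lines in each direction,
which is needed both to extend maps and to find a third point on `l`. -/

/-! ### Points and directions of a plane -/

/-- The points and the directions of an affine plane: `rel u A B` says that `A` and `B` lie on
a common line of direction `u`. -/
structure DirectedPlane (α Δ : Type*) where
  rel : Δ → α → α → Prop
  refl : ∀ u A, rel u A A
  symm : ∀ {u A B}, rel u A B → rel u B A
  trans : ∀ {u A B C}, rel u A B → rel u B C → rel u A C
  exists_dir : ∀ A B, ∃ u, rel u A B
  eq_of_rel : ∀ {u v A B}, u ≠ v → rel u A B → rel v A B → A = B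
  meet : ∀ {u v} A B, u ≠ v → ∃ P, rel u A P ∧ rel v B P
  exists_off : ∀ u A, ∃ B, ¬ rel u A B

namespace DirectedPlane

variable {α Δ : Type*} (S : DirectedPlane α Δ)

/-- Desargues' axiom for triangles with vertices on three parallel lines. -/
def ParallelDesargues : Prop :=
  ∀ u A A' B B' C C' v w x, S.rel u A A' → S.rel u B B' → S.rel u C C' →
    ¬ S.rel u A B → ¬ S.rel u B C → ¬ S.rel u A C →
    S.rel v A B → S.rel v A' B' → S.rel w B C → S.rel w B' C' → S.rel x A C → S.rel x A' C'

/-- Desargues' axiom for triangles with vertices on three concurrent lines. -/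
def CentralDesargues : Prop :=
  ∀ V a b c A A' B B' C C' v w x, a ≠ b → b ≠ c → a ≠ c →
    S.rel a V A → S.rel a V A' → S.rel b V B → S.rel b V B' → S.rel c V C → S.rel c V C' →
    A ≠ V → A' ≠ V → B ≠ V → B' ≠ V → C ≠ V → C' ≠ V →
    S.rel v A B → S.rel v A' B' → S.rel w B C → S.rel w B' C' → S.rel x A C → S.rel x A' C'

variable {S}

theorem dir_unique {u v : Δ} {A B : α} (h : A ≠ B) (hu : S.rel u A B) (hv : S.rel v A B) :
    u = v := by
  by_contra hne
  exact h (S.eq_of_rel hne hu hv)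

/-- Lines of different directions have at most one common point. -/
theorem meet_unique {u v : Δ} {A B P Q : α} (h : u ≠ v) (h1 : S.rel u A P) (h2 : S.rel u A Q)
    (h3 : S.rel v B P) (h4 : S.rel v B Q) : P = Q :=
  S.eq_of_rel h (S.trans (S.symm h1) h2) (S.trans (S.symm h3) h4)

theorem exists_dir_ne (S : DirectedPlane α Δ) (u : Δ) (A : α) : ∃ v, v ≠ u := by
  obtain ⟨B, hB⟩ := S.exists_off u A
  obtain ⟨v, hv⟩ := S.exists_dir A B
  exact ⟨v, fun h => hB (h ▸ hv)⟩

/-- There is a direction different from two given ones. -/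
theorem exists_third_dir (S : DirectedPlane α Δ) (u v : Δ) (A : α) : ∃ w, w ≠ u ∧ w ≠ v := by
  by_cases huv : u = v
  · subst huv
    obtain ⟨w, hw⟩ := S.exists_dir_ne u A
    exact ⟨w, hw, hw⟩
  obtain ⟨B, hB⟩ := S.exists_off u A
  obtain ⟨C, hC⟩ := S.exists_off v A
  obtain ⟨P, hP1, hP2⟩ := S.meet (A := A) (B := B) (Ne.symm huv)
  obtain ⟨Q, hQ1, hQ2⟩ := S.meet (A := A) (B := C) huv
  obtain ⟨w, hw⟩ := S.exists_dir P Q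
  have hPA : ¬ S.rel u A P := fun h => hB (S.trans h (S.symm hP2))
  have hQA : ¬ S.rel v A Q := fun h => hC (S.trans h (S.symm hQ2))
  refine ⟨w, ?_, ?_⟩
  · rintro rfl
    exact hPA (S.trans hQ1 (S.symm hw))
  · rintro rfl
    exact hQA (S.trans hP1 hw)

/-! ### Pencils and the maps that Desargues' axiom yields on them -/

/-- A pencil of lines as a partial equivalence relation `T` on the points: either a parallel
class, or the lines through a point `V` with `V` deleted. -/
structure IsPencil (S : DirectedPlane α Δ) (T : α → α → Prop) : Prop where
  symm : ∀ {A B}, T A B → T B A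
  trans : ∀ {A B C}, T A B → T B C → T A C
  collinear : ∀ {v A B C D}, T A B → T A C → T A D → A ≠ B → S.rel v A B → S.rel v C D
  exists_image : ∀ {v A A' B}, T A A' → T B B → ¬ T A B → S.rel v A B →
    ∃ B', T B B' ∧ S.rel v A' B'
  image_unique : ∀ {v A B B'}, T B B' → T A A → ¬ T A B → S.rel v A B → S.rel v A B' → B = B'
  desargues : ∀ {A A' B B' C C' v w x}, T A A' → T B B' → T C C' →
    ¬ T A B → ¬ T B C → ¬ T A C →
    S.rel v A B → S.rel v A' B' → S.rel w B C → S.rel w B' C' → S.rel x A C → S.rel x A' C'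
  exists_third : ∀ {A B}, T A A → T B B → ∃ C, T C C ∧ ¬ T A C ∧ ¬ T B C

/-- The image of a point `P` off the line of `A` is forced: it lies on the line of `P` in the pencil
and on the parallel to `AP` through `A'`. Points on the line of `A` are reached from a second base
point `B` instead. Desargues' axiom shows that the two recipes agree on directions. -/
theorem IsPencil.exists_map {T : α → α → Prop} (h : S.IsPencil T) {A A' : α} (hA : T A A') :
    ∃ f : α → α, f A = A' ∧ (∀ P, T P P → T P (f P)) ∧
      ∀ u P Q, T P P → T Q Q → S.rel u P Q → S.rel u (f P) (f Q) := by
  classical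
  have hAA : T A A := h.trans hA (h.symm hA)
  have hAA' : T A' A' := h.trans (h.symm hA) hA
  have key : ∀ {X X'}, T X X' → ∀ P, ∃ P', T P P → ¬ T X P →
      T P P' ∧ ∀ v, S.rel v X P → S.rel v X' P' := by
    intro X X' hX P
    by_cases hP : T P P ∧ ¬ T X P
    · obtain ⟨v, hv⟩ := S.exists_dir X P
      obtain ⟨P', h1, h2⟩ := h.exists_image hX hP.1 hP.2 hv
      refine ⟨P', fun _ _ => ⟨h1, fun w hw => ?_⟩⟩
      have : X ≠ P := by rintro rfl; exact hP.2 hP.1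
      rwa [dir_unique this hw hv]
    · exact ⟨P, fun h1 h2 => absurd ⟨h1, h2⟩ hP⟩
  choose g hg using key hA
  obtain ⟨B, hB, hAB, -⟩ := h.exists_third hAA hAA
  have hBg := hg B hB hAB
  choose k hk using key hBg.1
  have hBA : ¬ T B A := fun h' => hAB (h.symm h')
  -- `g` projects from the pair `A`, `A'`, and `k` from the pair `B`, `g B`; each is meaningful only
  -- off the line of its base point.
  set f : α → α := fun P => if T A P then k P else g P with hf
  have fin : ∀ {P}, T A P → f P = k P := fun hP => if_pos hP
  have fout : ∀ {P}, ¬ T A P → f P = g P := fun hP => if_neg hP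
  have hBin : ∀ {P}, T A P → ¬ T B P := fun hP hBP => hAB (h.trans hP (h.symm hBP))
  have hT : ∀ P, T P P → T P (f P) := by
    intro P hP
    by_cases hAP : T A P
    · rw [fin hAP]; exact (hk P hP (hBin hAP)).1
    · rw [fout hAP]; exact (hg P hP hAP).1
  have hfB : f B = g B := fout hAB
  have hfA : f A = A' := by
    obtain ⟨v, hv⟩ := S.exists_dir A B
    have h1 := hT A hAA
    have h2 : S.rel v (g B) (f A) := by
      rw [fin hAA]; exact (hk A hAA hBA).2 v (S.symm hv)
    have h3 := S.symm (hBg.2 v hv)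
    refine (h.image_unique (h.trans (h.symm h1) hA) (h.trans (h.symm hBg.1) hBg.1) ?_ h2 h3)
    intro h4
    exact hBA (h.trans hBg.1 (h.trans h4 (h.symm h1)))
  have hpar : ∀ u P Q, T P P → T Q Q → T P Q → S.rel u P Q → S.rel u (f P) (f Q) := by
    intro u P Q hP hQ hPQ hu
    by_cases hne : P = Q
    · subst hne; exact S.refl _ _
    · exact h.collinear hPQ (hT P hP) (h.trans hPQ (hT Q hQ)) hne hu
  have hout : ∀ u P Q, T P P → T Q Q → ¬ T A P → ¬ T A Q → S.rel u P Q →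
      S.rel u (f P) (f Q) := by
    intro u P Q hP hQ hAP hAQ hu
    by_cases hPQ : T P Q
    · exact hpar u P Q hP hQ hPQ hu
    obtain ⟨v, hv⟩ := S.exists_dir A P
    obtain ⟨w, hw⟩ := S.exists_dir A Q
    have e1 := (hg P hP hAP).2 v hv
    have e2 := (hg Q hQ hAQ).2 w hw
    rw [← fout hAP] at e1
    rw [← fout hAQ] at e2
    exact h.desargues (hT P hP) hA (hT Q hQ) (fun h' => hAP (h.symm h')) hAQ hPQ
      (S.symm hv) (S.symm e1) hw e2 hu
  have hmix1 : ∀ u P Q, T P P → T Q Q → T A P → ¬ T A Q → ¬ T B Q → S.rel u P Q →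
      S.rel u (f P) (f Q) := by
    intro u P Q hP hQ hAP hAQ hBQ hu
    obtain ⟨v, hv⟩ := S.exists_dir B P
    obtain ⟨w, hw⟩ := S.exists_dir B Q
    have e1 := (hk P hP (hBin hAP)).2 v hv
    rw [← fin hAP, ← hfB] at e1
    exact h.desargues (hT P hP) (hT B hB) (hT Q hQ) (fun h' => hBin hAP (h.symm h')) hBQ
      (fun h' => hAQ (h.trans hAP h')) (S.symm hv) (S.symm e1) hw (hout w B Q hB hQ hAB hAQ hw) hu
  have hmix : ∀ u P Q, T P P → T Q Q → T A P → ¬ T A Q → S.rel u P Q →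
      S.rel u (f P) (f Q) := by
    intro u P Q hP hQ hAP hAQ hu
    by_cases hBQ : T B Q
    -- If `Q` lies on the line of `B`, the triangle `P B Q` degenerates. A point `C` on a third line
    -- of the pencil replaces `B`.
    · obtain ⟨C, hC, hAC, hBC⟩ := h.exists_third hAA hB
      obtain ⟨v, hv⟩ := S.exists_dir P C
      obtain ⟨w, hw⟩ := S.exists_dir C Q
      exact h.desargues (hT P hP) (hT C hC) (hT Q hQ) (fun h' => hAC (h.trans hAP h'))
        (fun h' => hBC (h.trans hBQ (h.symm h'))) (fun h' => hAQ (h.trans hAP h'))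
        hv (hmix1 v P C hP hC hAP hAC hBC hv) hw (hout w C Q hC hQ hAC hAQ hw) hu
    · exact hmix1 u P Q hP hQ hAP hAQ hBQ hu
  refine ⟨f, hfA, hT, fun u P Q hP hQ hu => ?_⟩
  by_cases hAP : T A P
  · by_cases hAQ : T A Q
    · exact hpar u P Q hP hQ (h.trans (h.symm hAP) hAQ) hu
    · exact hmix u P Q hP hQ hAP hAQ hu
  · by_cases hAQ : T A Q
    · exact S.symm (hmix u Q P hQ hP hAQ hAP (S.symm hu))
    · exact hout u P Q hP hQ hAP hAQ hu

/-- Every direction has at least three lines. -/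
def HasThreeParallels (S : DirectedPlane α Δ) : Prop :=
  ∀ u A B, ∃ C, ¬ S.rel u A C ∧ ¬ S.rel u B C

theorem isPencil_parallel (hD : S.ParallelDesargues) (h3 : S.HasThreeParallels) (u : Δ) :
    S.IsPencil (S.rel u) where
  symm := S.symm
  trans := S.trans
  collinear := by
    intro v A B C D h1 h2 h3 hne hv
    rw [dir_unique hne hv h1]
    exact S.trans (S.symm h2) h3
  exists_image := by
    intro v A A' B h1 h2 h3 hv
    have huv : u ≠ v := by rintro rfl; exact h3 hv
    exact S.meet B A' huv
  image_unique := by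
    intro v A B B' h1 _ h3 hv hv'
    have huv : u ≠ v := by rintro rfl; exact h3 hv
    exact S.eq_of_rel huv h1 (S.trans (S.symm hv) hv')
  desargues := by
    intro A A' B B' C C' v w x
    exact hD u A A' B B' C C' v w x
  exists_third := by
    intro A B _ _
    obtain ⟨C, h1, h2⟩ := h3 u A B
    exact ⟨C, S.refl _ _, h1, h2⟩

theorem isPencil_central (hD : S.CentralDesargues) (V : α) :
    S.IsPencil (fun A B => A ≠ V ∧ B ≠ V ∧ ∃ a, S.rel a V A ∧ S.rel a V B) where
  symm := by
    rintro A B ⟨h1, h2, a, h3, h4⟩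
    exact ⟨h2, h1, a, h4, h3⟩
  trans := by
    rintro A B C ⟨h1, h2, a, h3, h4⟩ ⟨-, h6, b, h7, h8⟩
    obtain rfl := dir_unique h2.symm h4 h7
    exact ⟨h1, h6, a, h3, h8⟩
  collinear := by
    rintro v A B C D ⟨h1, h2, a, h3, h4⟩ ⟨-, h6, b, h7, h8⟩ ⟨-, h9, c, h10, h11⟩ hne hv
    obtain rfl := dir_unique h1.symm h3 h7
    obtain rfl := dir_unique h1.symm h3 h10
    obtain rfl := dir_unique hne hv (S.trans (S.symm h3) h4)
    exact S.trans (S.symm h8) h11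
  exists_image := by
    rintro v A A' B ⟨h1, h2, a, h3, h4⟩ ⟨h5, -, b, h6, -⟩ hn hv
    have hab : a ≠ b := by rintro rfl; exact hn ⟨h1, h5, a, h3, h6⟩
    have hAB : A ≠ B := by rintro rfl; exact hn ⟨h1, h1, a, h3, h3⟩
    have hbv : b ≠ v := by
      rintro rfl
      exact hab (dir_unique h1.symm h3 (S.trans h6 (S.symm hv)))
    have hav : a ≠ v := by
      rintro rfl
      exact hab (dir_unique h5.symm (S.trans h3 hv) h6)
    obtain ⟨P, hP1, hP2⟩ := S.meet V A' hbv
    refine ⟨P, ⟨h5, ?_, b, h6, hP1⟩, hP2⟩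
    rintro rfl
    exact h2 (S.eq_of_rel hav (S.symm h4) hP2)
  image_unique := by
    rintro v A B B' ⟨h1, h2, a, h3, h4⟩ ⟨h5, -, b, h6, -⟩ hn hv hv'
    have hav : a ≠ v := by
      rintro rfl
      exact hn ⟨h5, h1, a, S.trans h3 (S.symm hv), h3⟩
    exact S.eq_of_rel hav (S.trans (S.symm h3) h4) (S.trans (S.symm hv) hv')
  desargues := by
    rintro A A' B B' C C' v w x ⟨h1, h2, a, h3, h4⟩ ⟨h5, h6, b, h7, h8⟩ ⟨h9, h10, c, h11, h12⟩
      n1 n2 n3 e1 e2 e3 e4 e5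
    refine hD V a b c A A' B B' C C' v w x ?_ ?_ ?_ h3 h4 h7 h8 h11 h12 h1 h2 h5 h6 h9 h10
      e1 e2 e3 e4 e5
    · rintro rfl; exact n1 ⟨h1, h5, a, h3, h7⟩
    · rintro rfl; exact n2 ⟨h5, h9, b, h7, h11⟩
    · rintro rfl; exact n3 ⟨h1, h9, a, h3, h11⟩
  exists_third := by
    rintro A B ⟨h1, -, a, h3, -⟩ ⟨h5, -, b, h7, -⟩
    obtain ⟨c, hca, hcb⟩ := S.exists_third_dir a b V
    obtain ⟨Q, hQ⟩ := S.exists_off a V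
    obtain ⟨C, hC1, hC2⟩ := S.meet V Q hca
    have hCV : C ≠ V := by rintro rfl; exact hQ (S.symm hC2)
    refine ⟨C, ⟨hCV, hCV, c, hC1, hC1⟩, ?_, ?_⟩
    · rintro ⟨-, -, d, hd1, hd2⟩
      exact hca ((dir_unique hCV.symm hC1 hd2).trans (dir_unique h1.symm hd1 h3))
    · rintro ⟨-, -, d, hd1, hd2⟩
      exact hcb ((dir_unique hCV.symm hC1 hd2).trans (dir_unique h5.symm hd1 h7))

/-! ### Dilatations and translations -/

/-- A dilatation maps each line into a parallel one. -/
def IsDilatation (S : DirectedPlane α Δ) (f : α → α) : Prop :=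
  ∀ u A B, S.rel u A B → S.rel u (f A) (f B)

theorem IsDilatation.comp {f g : α → α} (hf : S.IsDilatation f) (hg : S.IsDilatation g) :
    S.IsDilatation (f ∘ g) := fun u A B h => hf u _ _ (hg u A B h)

theorem isDilatation_id (S : DirectedPlane α Δ) : S.IsDilatation id := fun _ _ _ h => h

/-- Dilatations need not be injective. The constant map is the one that represents multiplication by
zero. -/
theorem isDilatation_const (S : DirectedPlane α Δ) (V : α) : S.IsDilatation (fun _ => V) :=
  fun u _ _ _ => S.refl u V

/-- A dilatation is determined by the images of two points. -/
theorem IsDilatation.ext {f g : α → α} (hf : S.IsDilatation f) (hg : S.IsDilatation g)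
    {A B : α} (hAB : A ≠ B) (hA : f A = g A) (hB : f B = g B) : f = g := by
  have off : ∀ {A B : α} (w : Δ), f A = g A → f B = g B → A ≠ B → S.rel w A B →
      ∀ P, ¬ S.rel w A P → f P = g P := by
    intro A B w hA hB hAB hw P hP
    obtain ⟨u, hu⟩ := S.exists_dir A P
    obtain ⟨v, hv⟩ := S.exists_dir B P
    have hBP : B ≠ P := by rintro rfl; exact hP hw
    have huv : u ≠ v := by
      rintro rfl
      rw [dir_unique hAB hw (S.trans hu (S.symm hv))] at hP
      exact hP hu
    refine meet_unique huv (hf u A P hu) ?_ (hf v B P hv) ?_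
    · rw [hA]; exact hg u A P hu
    · rw [hB]; exact hg v B P hv
  obtain ⟨w, hw⟩ := S.exists_dir A B
  -- Points on the line `AB` itself are treated as points off the line `AC`.
  obtain ⟨C, hC⟩ := S.exists_off w A
  have hfC := off w hA hB hAB hw C hC
  have hAC : A ≠ C := by rintro rfl; exact hC (S.refl _ _)
  obtain ⟨u, hu⟩ := S.exists_dir A C
  funext P
  by_cases hP : S.rel w A P
  · by_cases hPA : A = P
    · rw [← hPA, hA]
    · refine off u hA hfC hAC hu P fun h => hC ?_
      rwa [dir_unique hPA hP h]
  · exact off w hA hB hAB hw P hP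

/-- A translation moves all points in one direction. -/
def IsTranslation (S : DirectedPlane α Δ) (f : α → α) : Prop :=
  S.IsDilatation f ∧ ∃ u, ∀ A, S.rel u A (f A)

theorem IsTranslation.eq_id {f : α → α} (hf : S.IsTranslation f) {A : α} (hA : f A = A) :
    f = id := by
  obtain ⟨hd, u, hu⟩ := hf
  obtain ⟨B, hB⟩ := S.exists_off u A
  obtain ⟨v, hv⟩ := S.exists_dir A B
  have hAB : A ≠ B := by rintro rfl; exact hB (S.refl _ _)
  refine hd.ext S.isDilatation_id hAB hA ?_
  have huv : u ≠ v := by rintro rfl; exact hB hv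
  have h1 := hd v A B hv
  rw [hA] at h1
  exact meet_unique huv (hu B) (S.refl _ _) h1 hv

theorem IsTranslation.rel_all {f : α → α} (hf : S.IsTranslation f) {u : Δ} {A : α}
    (h : S.rel u A (f A)) (B : α) : S.rel u B (f B) := by
  by_cases hA : f A = A
  · rw [hf.eq_id hA]; exact S.refl _ _
  · obtain ⟨hd, v, hv⟩ := hf
    rw [dir_unique (Ne.symm hA) h (hv A)]
    exact hv B

theorem IsTranslation.ext {f g : α → α} (hf : S.IsTranslation f) (hg : S.IsTranslation g)
    {A : α} (hA : f A = g A) : f = g := by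
  by_cases hfA : f A = A
  · rw [hf.eq_id hfA, hg.eq_id (hA ▸ hfA)]
  obtain ⟨u, hu⟩ := S.exists_dir A (f A)
  have hu' : S.rel u A (g A) := hA ▸ hu
  obtain ⟨B, hB⟩ := S.exists_off u A
  have hAB : A ≠ B := by rintro rfl; exact hB (S.refl _ _)
  obtain ⟨v, hv⟩ := S.exists_dir A B
  have huv : u ≠ v := by rintro rfl; exact hB hv
  refine hf.1.ext hg.1 hAB hA (meet_unique huv (hf.rel_all hu B) (hg.rel_all hu' B)
    (hf.1 v A B hv) ?_)
  rw [hA]; exact hg.1 v A B hv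

/-- If two points were moved by `f ∘ g` in different directions, the lines along which they move
would meet in a fixed point. So without fixed points there is a single direction. A fixed point, for
different directions of `f` and `g`, forces `g` to be the identity. -/
theorem IsTranslation.comp {f g : α → α} (hf : S.IsTranslation f) (hg : S.IsTranslation g) :
    S.IsTranslation (f ∘ g) := by
  obtain ⟨u, hu⟩ := hf.2
  obtain ⟨v, hv⟩ := hg.2
  refine ⟨hf.1.comp hg.1, ?_⟩
  by_cases huv : u = v
  · subst huv
    exact ⟨u, fun A => S.trans (hv A) (hu _)⟩
  have hd := hf.1.comp hg.1
  by_cases hfix : ∃ P, f (g P) = P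
  · obtain ⟨P, hP⟩ := hfix
    have hgP : P = g P := S.eq_of_rel huv (S.symm (by simpa only [hP] using hu (g P))) (hv P)
    rw [hg.eq_id hgP.symm]
    exact ⟨u, hu⟩
  · by_cases hα : Nonempty α
    · obtain ⟨A⟩ := hα
      obtain ⟨w, hw⟩ := S.exists_dir A (f (g A))
      refine ⟨w, fun B => ?_⟩
      obtain ⟨x, hx⟩ := S.exists_dir B (f (g B))
      by_cases hwx : w = x
      · rw [hwx]; exact hx
      obtain ⟨P, hP1, hP2⟩ := S.meet A B hwx
      exact absurd ⟨P, meet_unique hwx (S.trans hw (hd w A P hP1)) hP1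
        (S.trans hx (hd x B P hP2)) hP2⟩ hfix
    · exact ⟨u, fun A => absurd ⟨A⟩ hα⟩

theorem exists_translation (hD : S.ParallelDesargues) (h3 : S.HasThreeParallels) (A A' : α) :
    ∃ f, S.IsTranslation f ∧ f A = A' := by
  obtain ⟨u, hu⟩ := S.exists_dir A A'
  obtain ⟨f, h1, h2, h3⟩ := (isPencil_parallel hD h3 u).exists_map hu
  exact ⟨f, ⟨fun v P Q h => h3 v P Q (S.refl _ _) (S.refl _ _) h, u, fun P => h2 P (S.refl _ _)⟩,
    h1⟩

theorem exists_homothety (hD : S.CentralDesargues) {e : Δ} {V A A' : α} (hA : A ≠ V)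
    (h : S.rel e V A) (h' : S.rel e V A') : ∃ f, S.IsDilatation f ∧ f V = V ∧ f A = A' := by
  classical
  by_cases hA' : A' = V
  · subst hA'
    exact ⟨_, S.isDilatation_const A', rfl, rfl⟩
  obtain ⟨f, h1, h2, h3⟩ := (isPencil_central hD V).exists_map (A := A) (A' := A')
    ⟨hA, hA', e, h, h'⟩
  have hself : ∀ {P}, P ≠ V → P ≠ V ∧ P ≠ V ∧ ∃ a, S.rel a V P ∧ S.rel a V P := fun hP =>
    ⟨hP, hP, (S.exists_dir V _).imp fun a ha => ⟨ha, ha⟩⟩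
  have hray : ∀ {u P}, P ≠ V → S.rel u V P → S.rel u V (f P) := by
    intro u P hP hu
    obtain ⟨-, -, a, ha, ha'⟩ := h2 P (hself hP)
    rwa [dir_unique hP.symm hu ha]
  refine ⟨fun P => if P = V then V else f P, ?_, if_pos rfl, by simp [hA, h1]⟩
  intro u P Q hPQ
  by_cases hP : P = V <;> by_cases hQ : Q = V
  · simpa [hP, hQ] using S.refl u V
  · subst hP; simpa [hQ] using hray hQ hPQ
  · subst hQ; simpa [hP] using S.symm (hray hP (S.symm hPQ))
  · simpa [hP, hQ] using h3 u P Q (hself hP) (hself hQ) hPQ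

/-- A plane with five points has three lines in every direction. -/
theorem hasThreeParallels_of_injective (a : Fin 5 → α) (ha : Function.Injective a) :
    S.HasThreeParallels := by
  classical
  intro u A B
  by_contra! hcon
  have hcov : ∀ C, S.rel u A C ∨ S.rel u B C := fun C => by
    by_cases h : S.rel u A C
    · exact Or.inl h
    · exact Or.inr (hcon C h)
  have main : ∀ P Q : α, (∀ C, S.rel u P C ∨ S.rel u Q C) → ∀ P1 P2 P3, S.rel u P P1 →
      S.rel u P P2 → S.rel u P P3 → P1 ≠ P2 → P1 ≠ P3 → P2 ≠ P3 → False := by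
    intro P Q hcov P1 P2 P3 h1 h2 h3 h12 h13 h23
    have hPQ : ¬ S.rel u P Q := by
      intro h
      obtain ⟨C, hC⟩ := S.exists_off u P
      rcases hcov C with h' | h'
      · exact hC h'
      · exact hC (S.trans h h')
    obtain ⟨v, hv⟩ := S.exists_dir P1 Q
    obtain ⟨w, hw⟩ := S.exists_dir P2 Q
    have hvu : v ≠ u := by rintro rfl; exact hPQ (S.trans h1 hv)
    have hwu : w ≠ u := by rintro rfl; exact hPQ (S.trans h2 hw)
    have hvw : v ≠ w := by
      rintro rfl
      exact hvu (dir_unique h12 (S.trans hv (S.symm hw)) (S.trans (S.symm h1) h2))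
    -- `Z` is where `P1 Q` meets the parallel to `P2 Q` through `P3`. It can lie on neither of the
    -- two lines of direction `u`.
    obtain ⟨Z, hZ1, hZ2⟩ := S.meet P1 P3 hvw
    rcases hcov Z with hZ | hZ
    · have : P1 = Z := S.eq_of_rel hvu hZ1 (S.trans (S.symm h1) hZ)
      subst this
      exact hwu (dir_unique h13 (S.symm hZ2) (S.trans (S.symm h1) h3))
    · have : Q = Z := S.eq_of_rel hvu (S.trans (S.symm hv) hZ1) hZ
      subst this
      exact hwu (dir_unique h23 (S.trans hw (S.symm hZ2)) (S.trans (S.symm h2) h3))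
  -- If two lines covered the plane, one of them would contain three of the five points.
  obtain ⟨b, -, hb⟩ := Finset.exists_lt_card_fiber_of_mul_lt_card_of_maps_to
    (s := (Finset.univ : Finset (Fin 5))) (t := (Finset.univ : Finset Bool)) (n := 2)
    (f := fun i => decide (S.rel u A (a i))) (fun _ _ => Finset.mem_univ _) (by simp)
  obtain ⟨i, hi, j, hj, k, hk, hij, hik, hjk⟩ := Finset.two_lt_card.1 hb
  simp only [Finset.mem_filter, Finset.mem_univ, true_and] at hi hj hk
  cases b
  · simp only [decide_eq_false_iff_not] at hi hj hk
    exact main B A (fun C => (hcov C).symm) (a i) (a j) (a k) ((hcov _).resolve_left hi)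
      ((hcov _).resolve_left hj) ((hcov _).resolve_left hk) (ha.ne hij) (ha.ne hik) (ha.ne hjk)
  · simp only [decide_eq_true_eq] at hi hj hk
    exact main A B hcov (a i) (a j) (a k) hi hj hk (ha.ne hij) (ha.ne hik) (ha.ne hjk)

/-! ### The coordinate skew field -/

/-- Adding position vectors respects a direction: `g` is `f` followed by the translation taking `X`
to `X'`, which moves every point in direction `p`. -/
theorem IsTranslation.rel_add {p : Δ} {O X Y X' Y' : α} {f g : α → α} (hf : S.IsTranslation f)
    (hg : S.IsTranslation g) (hfO : f O = X) (hgO : g O = X')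
    (hex : ∀ A A', ∃ f, S.IsTranslation f ∧ f A = A') (hX : S.rel p X X') (hY : S.rel p Y Y') :
    S.rel p (f Y) (g Y') := by
  obtain ⟨s, hs, hsX⟩ := hex X X'
  have : g = s ∘ f := hg.ext (hs.comp hf) (A := O) (by simp [hfO, hgO, hsX])
  rw [this]
  exact S.trans (hf.1 p Y Y' hY) (hs.rel_all (hsX.symm ▸ hX) (f Y'))

/-- The skew field `K` on `L` describes the line of direction `e` through `O` and `I`, embedded
by `ι`: sums are obtained by translations and products by dilatations with centre `O`. -/
structure IsCoordinateField (S : DirectedPlane α Δ) {L : Type*} (ι : L → α) (O I : α)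
    (K : DivisionRing L) : Prop where
  zero_eq : ι K.zero = O
  one_eq : ι K.one = I
  add_eq : ∀ {A C : L} {f}, S.IsTranslation f → f O = ι A → ι (K.add A C) = f (ι C)
  mul_eq : ∀ {A C : L} {f}, S.IsDilatation f → f O = O → f I = ι A → ι (K.mul A C) = f (ι C)

variable {L : Type*} {ι : L → α} {O I : α} {e : Δ}

theorem exists_coordinateField (hP : S.ParallelDesargues) (hC : S.CentralDesargues)
    (h3 : S.HasThreeParallels) (hι : Function.Injective ι)
    (hrange : ∀ P, S.rel e O P ↔ ∃ x, ι x = P) (hOI : O ≠ I) (hI : S.rel e O I) :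
    ∃ K : DivisionRing L, S.IsCoordinateField ι O I K := by
  classical
  have hex := exists_translation hP h3
  have hmem : ∀ x, S.rel e O (ι x) := fun x => (hrange _).2 ⟨x, rfl⟩
  choose t ht htO using hex O
  have hte : ∀ A : L, ∀ P, S.rel e P (t (ι A) P) := fun A P =>
    (ht _).rel_all (A := O) ((htO (ι A)).symm ▸ hmem A) P
  have hδ : ∀ A : L, ∃ f, S.IsDilatation f ∧ f O = O ∧ f I = ι A := fun A =>
    exists_homothety hC hOI.symm hI (hmem A)
  choose m hm hmO hmI using hδ
  have hme : ∀ A P, S.rel e O P → S.rel e O (m A P) := fun A P h => by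
    have := hm A e O P h
    rwa [hmO] at this
  obtain ⟨z, hz⟩ := (hrange O).1 (S.refl _ _)
  obtain ⟨i, hi⟩ := (hrange I).1 hI
  have hadd : ∀ A C : L, ∃ X, ι X = t (ι A) (ι C) := fun A C =>
    (hrange _).1 (S.trans (hmem C) (hte A _))
  have hmul : ∀ A C : L, ∃ X, ι X = m A (ι C) := fun A C => (hrange _).1 (hme A _ (hmem C))
  choose add hadd using hadd
  choose mul hmul using hmul
  have t_add : ∀ A C, t (ι (add A C)) = t (ι A) ∘ t (ι C) := fun A C =>
    (ht _).ext ((ht _).comp (ht _)) (A := O) (by simp [htO, hadd])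
  have m_mul : ∀ A C, m (mul A C) = m A ∘ m C := fun A C =>
    (hm _).ext ((hm _).comp (hm _)) hOI (by simp [hmO]) (by simp [hmI, hmul])
  have hneg : ∀ A : L, ∃ X, t (ι X) (ι A) = O := by
    intro A
    obtain ⟨f, hf, hfA⟩ := hex (ι A) O
    have h1 : S.rel e O (f O) := hf.rel_all (A := ι A) (hfA.symm ▸ S.symm (hmem A)) O
    obtain ⟨X, hX⟩ := (hrange _).1 h1
    refine ⟨X, ?_⟩
    rw [← hfA, (ht (ι X)).ext hf (A := O) (by rw [htO, hX])]
  choose neg hneg using hneg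
  have hinv : ∀ A : L, ∃ X, (A = z → X = z) ∧ (A ≠ z → m X (ι A) = I) := by
    intro A
    by_cases hA : A = z
    · exact ⟨z, fun _ => rfl, fun h => absurd hA h⟩
    have hAO : ι A ≠ O := fun h => hA (hι (h.trans hz.symm))
    obtain ⟨f, hf, hfO, hfA⟩ := exists_homothety hC hAO (hmem A) hI
    have h1 := hf e O I hI
    rw [hfO] at h1
    obtain ⟨X, hX⟩ := (hrange _).1 h1
    refine ⟨X, fun h => absurd h hA, fun _ => ?_⟩
    rw [(hm X).ext hf hOI (by rw [hmO, hfO]) (by rw [hmI, hX]), hfA]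
  choose inv hinv0 hinv using hinv
  have m_z : m z = fun _ => O :=
    (hm z).ext (S.isDilatation_const O) hOI (hmO z) (by rw [hmI, hz])
  have m_i : m i = id := (hm i).ext S.isDilatation_id hOI (hmO i) (by rw [hmI, hi]; rfl)
  have t_z : t (ι z) = id := (ht _).eq_id (A := O) (by rw [htO, hz])
  obtain ⟨B, hB⟩ := S.exists_off e O
  have hOB : O ≠ B := by rintro rfl; exact hB (S.refl _ _)
  obtain ⟨b, hb⟩ := S.exists_dir O B
  have hbe : e ≠ b := by rintro rfl; exact hB hb
  -- Left distributivity in terms of maps: conjugating a translation by a dilatation with centre `O`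
  -- gives a translation.
  have conj : ∀ A C, m A ∘ t (ι C) = t (ι (mul A C)) ∘ m A := by
    intro A C
    refine ((hm A).comp (ht _).1).ext ((ht _).1.comp (hm A)) hOB
      (by simp [htO, hmO, hmul]) ?_
    have h1 : S.rel b (ι C) (t (ι C) B) := by simpa only [htO] using (ht (ι C)).1 b O B hb
    have h2 : S.rel b O (m A B) := by simpa only [hmO] using hm A b O B hb
    have h3 := (ht (ι (mul A C))).1 b _ _ h2
    rw [htO] at h3
    have h4 := hm A b _ _ h1
    rw [← hmul] at h4
    exact meet_unique hbe (hm A e _ _ (hte C B)) (hte (mul A C) (m A B))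
      h4 h3
  have hLdist : ∀ A C D, mul A (add C D) = add (mul A C) (mul A D) := by
    intro A C D
    apply hι
    simpa [hmul, hadd] using congrFun (conj A C) (ι D)
  have hRdist : ∀ A C D, mul (add A C) D = add (mul A D) (mul C D) := by
    intro A C D
    apply hι
    -- The points `m x B` copy the line `OI` onto `OB` along direction `p`, and direction `q`
    -- carries them back to the points `x * D`. Both correspondences are additive by `rel_add`.
    obtain ⟨p, hp⟩ := S.exists_dir I B
    obtain ⟨q, hq⟩ := S.exists_dir B (ι D)
    have hpb : p ≠ b := by
      rintro rfl
      exact hbe (dir_unique hOI hI (S.trans hb (S.symm hp)))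
    have hqe : e ≠ q := by
      rintro rfl
      exact hB (S.trans (hmem D) (S.symm hq))
    have hφ : ∀ x, S.rel p (ι x) (m x B) := fun x => by simpa only [hmI] using hm x p I B hp
    have hφb : ∀ x, S.rel b O (m x B) := fun x => by simpa only [hmO] using hm x b O B hb
    have hψ : ∀ x, S.rel q (m x B) (ι (mul x D)) := fun x => by
      rw [hmul]; exact hm x q B (ι D) hq
    have h1 : S.rel p (t (ι A) (ι C)) (t (m A B) (m C B)) :=
      (ht _).rel_add (ht _) (htO _) (htO _) hex (hφ A) (hφ C)
    rw [← hadd] at h1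
    have h2 : S.rel b O (t (m A B) (m C B)) := by
      refine S.trans (hφb C) ((ht _).rel_all (A := O) ?_ _)
      rw [htO]; exact hφb A
    have h4 : t (m A B) (m C B) = m (add A C) B :=
      meet_unique hpb h1 (hφ _) h2 (hφb _)
    have h5 : S.rel q (t (m A B) (m C B)) (t (ι (mul A D)) (ι (mul C D))) :=
      (ht _).rel_add (ht _) (htO _) (htO _) hex (hψ A) (hψ C)
    rw [← hadd, h4] at h5
    exact meet_unique hqe (hmem _) (hmem _) (hψ _) h5
  have hassoc : ∀ A C D, add (add A C) D = add A (add C D) := fun A C D => hι (by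
    rw [hadd, t_add, hadd, hadd]; rfl)
  have hmassoc : ∀ A C D, mul (mul A C) D = mul A (mul C D) := fun A C D => hι (by
    rw [hmul, m_mul, hmul, hmul]; rfl)
  have hzadd : ∀ A, add z A = A := fun A => hι (by rw [hadd, t_z]; rfl)
  have haddz : ∀ A, add A z = A := fun A => hι (by rw [hadd, hz, htO])
  have hnegadd : ∀ A, add (neg A) A = z := fun A => hι (by rw [hadd, hneg, hz])
  have hzmul : ∀ A, mul z A = z := fun A => hι (by rw [hmul, m_z, hz])
  have hmulz : ∀ A, mul A z = z := fun A => hι (by rw [hmul, hz, hmO])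
  have homul : ∀ A, mul i A = A := fun A => hι (by rw [hmul, m_i]; rfl)
  have hmulo : ∀ A, mul A i = A := fun A => hι (by rw [hmul, hi, hmI])
  have hlcancel : ∀ A C D, add A C = add A D → C = D := fun A C D h => by
    rw [← hzadd C, ← hzadd D, ← hnegadd A, hassoc, hassoc, h]
  have haddneg : ∀ A, add A (neg A) = z := fun A => hlcancel (neg A) _ _ (by
    rw [← hassoc, hnegadd, hzadd, haddz])
  have hrcancel : ∀ A C D, add C A = add D A → C = D := fun A C D h => by
    rw [← haddz C, ← haddz D, ← haddneg A, ← hassoc, ← hassoc, h]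
  have hcomm : ∀ A C, add A C = add C A := fun A C => by
    -- Expanding `(1 + 1) * (A + C)` by both distributive laws and cancelling the outer terms gives
    -- commutativity of addition.
    have h1 := hLdist (add i i) A C
    rw [hRdist, hRdist, hRdist, homul, homul, homul, hassoc, hassoc] at h1
    have h2 := hlcancel _ _ _ h1
    rw [← hassoc, ← hassoc] at h2
    exact (hrcancel _ _ _ h2).symm
  have hzi : i ≠ z := fun h => hOI (by rw [← hz, ← hi, h])
  have hinvmul : ∀ A, A ≠ z → mul (inv A) A = i := fun A hA => hι (by rw [hmul, hinv A hA, hi])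
  have hinvne : ∀ A, A ≠ z → inv A ≠ z := fun A hA h => hzi (by
    rw [← hinvmul A hA, h, hzmul])
  have hmulinv : ∀ A, A ≠ z → mul A (inv A) = i := fun A hA => by
    have h1 := hinvmul _ (hinvne A hA)
    rw [← homul (mul A (inv A)), ← h1, hmassoc, ← hmassoc (inv A) A, hinvmul A hA, homul]
  let _ : Zero L := ⟨z⟩
  let _ : Add L := ⟨add⟩
  let _ : Neg L := ⟨neg⟩
  let R : Ring L :=
    { zero := z, one := i, add := add, mul := mul, neg := neg
      add_assoc := hassoc, zero_add := hzadd, add_zero := haddz, add_comm := hcomm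
      left_distrib := hLdist, right_distrib := hRdist, zero_mul := hzmul, mul_zero := hmulz
      mul_assoc := hmassoc, one_mul := homul, mul_one := hmulo, neg_add_cancel := hnegadd
      nsmul := nsmulRec, zsmul := zsmulRec }
  let K : DivisionRing L :=
    { R with
      inv := inv
      exists_pair_ne := ⟨i, z, hzi⟩
      mul_inv_cancel := hmulinv
      inv_zero := hinv0 z rfl
      nnqsmul := _
      nnqsmul_def := fun _ _ => rfl
      qsmul := _
      qsmul_def := fun _ _ => rfl }
  refine ⟨K, hz, hi, ?_, ?_⟩
  · intro A C f hf hfO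
    change ι (add A C) = _
    rw [hadd, (ht _).ext hf (A := O) (by rw [htO, hfO])]
  · intro A C f hf hfO hfI
    change ι (mul A C) = _
    rw [hmul, (hm A).ext hf hOI (by rw [hmO, hfO]) (by rw [hmI, hfI])]

/-! ### Betweenness under sums and products -/

/-- Parallel projections between lines preserve the relation `btw`. -/
def ProjectionsPreserve (S : DirectedPlane α Δ) (btw : α → α → α → Prop) : Prop :=
  ∀ {u v d A B C A' B' C'}, d ≠ u → d ≠ v → S.rel u A B → S.rel u A C → S.rel v A' B' →
    S.rel v A' C' → S.rel d A A' → S.rel d B B' → S.rel d C C' → btw A B C → btw A' B' C'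

/-- The translation `O ↦ A` is split as `O ↦ B ↦ A` with `B` off the line. On the line each factor
acts as a parallel projection, to the parallel through `B` and back. -/
theorem IsCoordinateField.btw_add {K : DivisionRing L} (hK : S.IsCoordinateField ι O I K)
    {btw : α → α → α → Prop} (hbtw : S.ProjectionsPreserve btw)
    (hex : ∀ A A', ∃ f, S.IsTranslation f ∧ f A = A') (hmem : ∀ x, S.rel e O (ι x))
    (A X Y Z : L) (h : btw (ι X) (ι Y) (ι Z)) : btw (ι (A + X)) (ι (A + Y)) (ι (A + Z)) := by
  obtain ⟨B, hB⟩ := S.exists_off e O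
  obtain ⟨f, hf, hfO⟩ := hex O B
  obtain ⟨g, hg, hgB⟩ := hex B (ι A)
  have hadd : ∀ C, ι (A + C) = g (f (ι C)) := fun C =>
    hK.add_eq (hg.comp hf) (by simp [hfO, hgB])
  obtain ⟨b, hb⟩ := S.exists_dir O B
  obtain ⟨p, hp⟩ := S.exists_dir B (ι A)
  have hbe : b ≠ e := by rintro rfl; exact hB hb
  have hpe : p ≠ e := by rintro rfl; exact hB (S.trans (hmem A) (S.symm hp))
  have hf' := hf.rel_all (hfO.symm ▸ hb)
  have hg' := hg.rel_all (hgB.symm ▸ hp)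
  have he : ∀ x y, S.rel e (ι x) (ι y) := fun x y => S.trans (S.symm (hmem x)) (hmem y)
  have hfe := fun x y => hf.1 e _ _ (he x y)
  rw [hadd, hadd, hadd]
  exact hbtw hpe hpe (hfe X Y) (hfe X Z) (hg.1 e _ _ (hfe X Y)) (hg.1 e _ _ (hfe X Z))
    (hg' _) (hg' _) (hg' _)
    (hbtw hbe hbe (he X Y) (he X Z) (hfe X Y) (hfe X Z) (hf' _) (hf' _) (hf' _) h)

/-- `X ↦ X * D` is the projection of the line `OI` to `OB` along `IB`, followed by the projection
back along `BD`. -/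
theorem IsCoordinateField.btw_mul {K : DivisionRing L} (hK : S.IsCoordinateField ι O I K)
    {btw : α → α → α → Prop} (hbtw : S.ProjectionsPreserve btw) (hC : S.CentralDesargues)
    (hι : Function.Injective ι) (hmem : ∀ x, S.rel e O (ι x)) (hOI : O ≠ I) (hI : S.rel e O I)
    (D X Y Z : L) (hD : D ≠ 0) (h : btw (ι X) (ι Y) (ι Z)) :
    btw (ι (X * D)) (ι (Y * D)) (ι (Z * D)) := by
  obtain ⟨B, hB⟩ := S.exists_off e O
  choose m hm hmO hmI using fun A : L => exists_homothety hC hOI.symm hI (hmem A)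
  have hmul : ∀ A, ι (A * D) = m A (ι D) := fun A => hK.mul_eq (hm A) (hmO A) (hmI A)
  obtain ⟨b, hb⟩ := S.exists_dir O B
  obtain ⟨p, hp⟩ := S.exists_dir I B
  obtain ⟨q, hq⟩ := S.exists_dir B (ι D)
  have hDO : ι D ≠ O := fun h => hD (hι (h.trans hK.zero_eq.symm))
  have hbe : b ≠ e := by rintro rfl; exact hB hb
  have hpe : p ≠ e := by rintro rfl; exact hB (S.trans hI hp)
  have hpb : p ≠ b := by
    rintro rfl; exact hbe (dir_unique hOI (S.trans hb (S.symm hp)) hI)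
  have hqe : q ≠ e := by rintro rfl; exact hB (S.trans (hmem D) (S.symm hq))
  have hqb : q ≠ b := by
    rintro rfl; exact hbe (dir_unique hDO.symm (S.trans hb hq) (hmem D))
  have hφ : ∀ x, S.rel p (ι x) (m x B) := fun x => by simpa only [hmI] using hm x p I B hp
  have hφb : ∀ x, S.rel b O (m x B) := fun x => by simpa only [hmO] using hm x b O B hb
  have hψ : ∀ x, S.rel q (m x B) (ι (x * D)) := fun x => by
    rw [hmul]; exact hm x q B (ι D) hq
  have he : ∀ x y, S.rel e (ι x) (ι y) := fun x y => S.trans (S.symm (hmem x)) (hmem y)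
  have hb' : ∀ x y, S.rel b (m x B) (m y B) := fun x y => S.trans (S.symm (hφb x)) (hφb y)
  exact hbtw hqb hqe (hb' X Y) (hb' X Z) (he _ _) (he _ _) (hψ _) (hψ _) (hψ _)
    (hbtw hpe hpb (he X Y) (he X Z) (hb' X Y) (hb' X Z) (hφ _) (hφ _) (hφ _) h)

end DirectedPlane

/-! ### Ordered lines and ordered skew fields -/

namespace AffinePlane

section OrderedLine

variable {L : Type*} {btw : L → L → L → Prop}

theorem IsOrderedLine.not_rotate (h : IsOrderedLine btw Set.univ) {A B C : L} (hb : btw A B C) :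
    ¬ btw B C A ∧ ¬ btw C A B := by
  obtain ⟨h1, h2, h3⟩ := h.distinct A trivial B trivial C trivial hb
  rcases h.exactly_one A trivial B trivial C trivial h1 h2 h3 with h' | h' | h' <;> tauto

theorem IsOrderedLine.comm (h : IsOrderedLine btw Set.univ) {A B C : L} (hb : btw A B C) :
    btw C B A := h.symm A trivial B trivial C trivial hb

/-- Two points opposite to a third one with respect to `O` are not opposite to each other. -/
theorem IsOrderedLine.not_opposite (h : IsOrderedLine btw Set.univ) {O x y z : L}
    (hxy : btw x O y) (hyz : btw y O z) : ¬ btw x O z := by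
  intro hxz
  have hne := (h.distinct x trivial O trivial z trivial hxz).2.2
  rcases h.same_side x trivial O trivial y trivial z trivial hne hxy hyz with h' | h'
  · exact (h.not_rotate hxz).2 h'
  · exact (h.not_rotate hxz).1 (h.comm h')

/-- If `y` is on the same side of `O` as `x` and as `z`, then `x` and `z` are on the same side. -/
theorem IsOrderedLine.same_side_trans (h : IsOrderedLine btw Set.univ) {O x y z : L}
    (hy : y ≠ O) (hxy : ¬ btw x O y) (hyz : ¬ btw y O z) : ¬ btw x O z := by
  intro hxz
  obtain ⟨hx, hz, hne⟩ := h.distinct x trivial O trivial z trivial hxz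
  have side : ∀ {a}, a ≠ O → a ≠ y → ¬ btw a O y → btw O a y ∨ btw O y a := by
    intro a ha hay hn
    rcases h.exactly_one a trivial O trivial y trivial ha hy.symm hay with h' | h' | h'
    · exact absurd h'.1 hn
    · exact Or.inr h'.2.1
    · exact Or.inl (h.comm h'.2.2)
  by_cases hxy' : x = y
  · exact hyz (hxy' ▸ hxz)
  by_cases hzy' : z = y
  · exact hxy (hzy' ▸ hxz)
  rcases side hx hxy' hxy with h1 | h1
  · exact hyz (h.comm (h.extend z trivial O trivial x trivial y trivial (h.comm hxz) h1).1)
  rcases side hz.symm hzy' (fun h' => hyz (h.comm h')) with h2 | h2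
  · exact hxy (h.extend x trivial O trivial z trivial y trivial hxz h2).1
  -- What remains is that `y` lies between `O` and both `x` and `z`. Then `x` and `z` follow each
  -- other on one ray from `O`, although `O` lies between them.
  rcases h.same_side x trivial y trivial O trivial z trivial hne (h.comm h1) h2 with h3 | h3
  · have := (h.extend z trivial x trivial y trivial O trivial h3 (h.comm h1)).1
    exact (h.not_rotate hxz).2 this
  · have := (h.extend x trivial z trivial y trivial O trivial h3 (h.comm h2)).1
    exact (h.not_rotate hxz).1 (h.comm this)

/-- In characteristic two any betweenness can be normalised to `btw 1 0 c`. Its translates by `1`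
and by `c` then put both `0` and `c` between the other two of the points `0`, `c`, `1 + c`. -/
theorem IsOrderedLine.one_add_one_ne_zero [K : DivisionRing L]
    (h : IsOrderedLine btw Set.univ)
    (hadd : ∀ A X Y Z : L, btw X Y Z → btw (A + X) (A + Y) (A + Z))
    (hmul : ∀ D X Y Z : L, D ≠ 0 → btw X Y Z → btw (X * D) (Y * D) (Z * D))
    {r : L} (hr0 : r ≠ 0) (hr1 : r ≠ 1) :
    (1 + 1 : L) ≠ 0 := by
  intro h2
  have hdbl : ∀ x : L, x + x = 0 := fun x => by rw [← one_mul x, ← add_mul, h2, zero_mul]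
  have hbet : ∃ p q s : L, btw p q s := by
    rcases h.exactly_one 0 trivial 1 trivial r trivial zero_ne_one hr1.symm hr0.symm
      with h' | h' | h'
    · exact ⟨_, _, _, h'.1⟩
    · exact ⟨_, _, _, h'.2.1⟩
    · exact ⟨_, _, _, h'.2.2⟩
  obtain ⟨p, q, s, hb⟩ := hbet
  have hpq := (h.distinct _ trivial _ trivial _ trivial hb).1
  have hne : q + p ≠ 0 := fun h' => hpq (by
    rw [← zero_add p, ← hdbl q, add_assoc, h', add_zero])
  have hb1 := hmul (q + p)⁻¹ _ _ _ (inv_ne_zero hne) (hadd q _ _ _ hb)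
  rw [mul_inv_cancel₀ hne, hdbl, zero_mul] at hb1
  set c := (q + s) * (q + p)⁻¹
  have e1 := hadd 1 _ _ _ hb1
  have e2 := hadd c _ _ _ hb1
  rw [h2, add_zero] at e1
  rw [hdbl, add_zero, add_comm c 1] at e2
  exact (h.not_rotate (h.comm e2)).2
    (h.comm (h.extend c trivial 0 trivial 1 trivial (1 + c) trivial (h.comm hb1) e1).1)

/-- A betweenness relation that is invariant under translations and right multiplications
orders a skew field with more than two elements. -/
theorem IsOrderedLine.isOrderedSkewField [K : DivisionRing L]
    (h : IsOrderedLine btw Set.univ)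
    (hadd : ∀ A X Y Z : L, btw X Y Z → btw (A + X) (A + Y) (A + Z))
    (hmul : ∀ D X Y Z : L, D ≠ 0 → btw X Y Z → btw (X * D) (Y * D) (Z * D))
    {r : L} (hr0 : r ≠ 0) (hr1 : r ≠ 1) :
    IsOrderedSkewField K {x | btw x 0 1} {x | x = 1 ∨ btw 0 x 1 ∨ btw 0 1 x} := by
  have h2 := h.one_add_one_ne_zero hadd hmul hr0 hr1
  have hne : ∀ {x y z}, btw x y z → x ≠ y ∧ y ≠ z ∧ x ≠ z := fun hb =>
    h.distinct _ trivial _ trivial _ trivial hb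
  have hpos : ∀ x : L, (x = 1 ∨ btw 0 x 1 ∨ btw 0 1 x) ↔ x ≠ 0 ∧ ¬ btw x 0 1 := by
    intro x
    constructor
    · rintro (rfl | hx | hx)
      · exact ⟨one_ne_zero, fun h' => (hne h').2.2 rfl⟩
      · exact ⟨(hne hx).1.symm, fun h' => (h.not_rotate hx).2 (h.comm h')⟩
      · exact ⟨(hne hx).2.2.symm, fun h' => (h.not_rotate hx).2 h'⟩
    · rintro ⟨hx, hn⟩
      by_cases hx1 : x = 1
      · exact Or.inl hx1
      rcases h.exactly_one x trivial 0 trivial 1 trivial hx zero_ne_one hx1 with h' | h' | h'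
      · exact absurd h'.1 hn
      · exact Or.inr (Or.inr h'.2.1)
      · exact Or.inr (Or.inl (h.comm h'.2.2))
  have hopp : ∀ {x : L}, x ≠ 0 → btw x 0 (-x) := by
    intro x hx
    have hxx : x ≠ -x := by
      intro h'
      have h1 : (1 + 1) * x = 0 := by
        rw [add_mul, one_mul]; nth_rewrite 2 [h']; exact add_neg_cancel x
      exact (mul_ne_zero h2 hx) h1
    -- Multiplication by `-1` exchanges `y` and `-y`, so each would lie between `0` and the other.
    have hflip : ∀ {y : L}, ¬ btw 0 y (-y) := by
      intro y hb
      have h1 := hmul (-1) _ _ _ (neg_ne_zero.2 one_ne_zero) hb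
      simp only [mul_neg, mul_one, neg_zero, neg_neg] at h1
      exact (h.not_rotate hb).1 (h.comm h1)
    rcases h.exactly_one x trivial 0 trivial (-x) trivial hx (neg_ne_zero.2 hx).symm hxx
      with h' | h' | h'
    · exact h'.1
    · have := h'.2.1
      refine absurd (?_ : btw 0 (-x) (- -x)) hflip
      rwa [neg_neg]
    · exact absurd (h.comm h'.2.2) hflip
  have hposmem : ∀ {x : L}, x ∈ {x | x = 1 ∨ btw 0 x 1 ∨ btw 0 1 x} ↔ x ≠ 0 ∧ ¬ btw x 0 1 :=
    fun {x} => hpos x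
  refine ⟨?_, ?_, ?_, ?_, ?_, ?_, ?_⟩
  · ext x
    simp only [Set.mem_union, Set.mem_univ, iff_true, hposmem, Set.mem_ofPred_eq,
      Set.mem_singleton_iff]
    tauto
  · exact fun h' => (hne h').1 rfl
  · exact fun h' => (hposmem.1 h').1 rfl
  · rw [Set.disjoint_left]
    exact fun x hx h' => (hposmem.1 h').2 hx
  · intro x
    rw [hposmem, Set.mem_ofPred_eq]
    constructor
    · intro hx
      have hx0 := (hne hx).1
      exact ⟨neg_ne_zero.2 hx0, fun h' => h.not_opposite (hopp hx0) h' hx⟩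
    · rintro ⟨hx, hn⟩
      have hx0 := neg_ne_zero.1 hx
      by_contra hx1
      exact h.same_side_trans one_ne_zero hx1 (fun h' => hn (h.comm h')) (hopp hx0)
  · intro a ha b hb
    rw [hposmem] at ha hb ⊢
    obtain ⟨ha0, ha⟩ := ha
    obtain ⟨hb0, hb⟩ := hb
    have hab : ¬ btw a 0 b := h.same_side_trans one_ne_zero ha fun h' => hb (h.comm h')
    refine ⟨fun h' => hab ?_, fun h' => ?_⟩
    · rw [eq_neg_of_add_eq_zero_right h']; exact hopp ha0
    -- If `a + b` were negative, `0` would lie between `a + b` and `a`. Translation by `-a` puts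
    -- `-a` between `b` and `0`, whereas `b` and `-a` lie on opposite sides of `0`.
    · have h1 : btw (a + b) 0 a := by
        by_contra h'
        exact h.same_side_trans ha0 h' ha ‹_›
      have h3 := hadd (-a) _ _ _ h1
      rw [neg_add_cancel_left, add_zero, neg_add_cancel] at h3
      have h4 : btw b 0 (-a) := by
        by_contra h'
        exact h.same_side_trans hb0 hab h' (hopp ha0)
      exact (h.not_rotate h4).1 (h.comm h3)
  · intro a ha b hb
    rw [hposmem] at ha hb ⊢
    obtain ⟨ha0, ha⟩ := ha
    obtain ⟨hb0, hb⟩ := hb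
    -- Right multiplication by the inverse of `b` reduces the comparison of `a * b` with `b` to that
    -- of `a` with `1`.
    refine ⟨mul_ne_zero ha0 hb0, h.same_side_trans hb0 (fun h' => ha ?_) hb⟩
    have := hmul b⁻¹ _ _ _ (inv_ne_zero hb0) h'
    rwa [mul_inv_cancel_right₀ hb0, zero_mul, mul_inv_cancel₀ hb0] at this

end OrderedLine
end AffinePlane

/-! ### From the affine plane to points and directions -/

namespace AffinePlane

variable {X : Type*} (𝒜 : AffinePlane X)

variable {𝒜} in
theorem line_eq {l m : Set X} (hl : l ∈ 𝒜.lines) (hm : m ∈ 𝒜.lines) {P Q : X} (hPQ : P ≠ Q)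
    (h1 : P ∈ l) (h2 : Q ∈ l) (h3 : P ∈ m) (h4 : Q ∈ m) : l = m :=
  (𝒜.line_through P (𝒜.line_subset l hl h1) Q (𝒜.line_subset l hl h2) hPQ).unique
    ⟨hl, h1, h2⟩ ⟨hm, h3, h4⟩

theorem Parallel.symm {l m : Set X} (h : Parallel l m) : Parallel m l :=
  h.imp Eq.symm fun h => by rwa [Set.inter_comm]

theorem Parallel.eq_of_mem {l m : Set X} (h : Parallel l m) {P : X} (h1 : P ∈ l) (h2 : P ∈ m) :
    l = m :=
  h.resolve_right fun h => (h ▸ (⟨h1, h2⟩ : P ∈ l ∩ m) : P ∈ (∅ : Set X))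

variable {𝒜} in
theorem Parallel.trans {l m n : Set X} (hl : l ∈ 𝒜.lines) (hm : m ∈ 𝒜.lines) (hn : n ∈ 𝒜.lines)
    (h1 : Parallel l m) (h2 : Parallel m n) : Parallel l n := by
  by_cases h : (l ∩ n).Nonempty
  · obtain ⟨P, hPl, hPn⟩ := h
    left
    by_cases hPm : P ∈ m
    · exact (h1.eq_of_mem hPl hPm).trans (h2.eq_of_mem hPm hPn)
    · refine (𝒜.playfair P (𝒜.line_subset l hl hPl) m hm hPm).unique ⟨hl, hPl, ?_⟩ ⟨hn, hPn, ?_⟩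
      · exact h1.symm.resolve_left fun h => hPm (h ▸ hPl)
      · exact h2.resolve_left fun h => hPm (h ▸ hPn)
  · exact Or.inr (Set.not_nonempty_iff_eq_empty.1 h)

/-- Parallelism as an equivalence relation on the lines. -/
def parallelSetoid : Setoid 𝒜.lines where
  r l m := Parallel (l : Set X) m
  iseqv := ⟨fun _ => Or.inl rfl, Parallel.symm, fun {l m n} =>
    Parallel.trans l.2 m.2 n.2⟩

/-- The directions of the lines. -/
def Direction : Type _ := Quotient 𝒜.parallelSetoid

/-- The direction of a line. -/
def direction (l : Set X) (hl : l ∈ 𝒜.lines) : 𝒜.Direction :=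
  Quotient.mk 𝒜.parallelSetoid ⟨l, hl⟩

variable {𝒜}

theorem direction_eq_iff {l m : Set X} {hl : l ∈ 𝒜.lines} {hm : m ∈ 𝒜.lines} :
    𝒜.direction l hl = 𝒜.direction m hm ↔ Parallel l m :=
  Quotient.eq (r := 𝒜.parallelSetoid)

theorem Direction.exists_rep (u : 𝒜.Direction) : ∃ l, ∃ hl : l ∈ 𝒜.lines, 𝒜.direction l hl = u := by
  obtain ⟨⟨l, hl⟩, h⟩ := Quotient.exists_rep u
  exact ⟨l, hl, h⟩

theorem exists_parallel_through {l : Set X} (hl : l ∈ 𝒜.lines) {P : X} (hP : P ∈ 𝒜.points) :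
    ∃ m ∈ 𝒜.lines, P ∈ m ∧ Parallel l m := by
  by_cases h : P ∈ l
  · exact ⟨l, hl, h, Or.inl rfl⟩
  · obtain ⟨m, hm, -⟩ := 𝒜.playfair P hP l hl h
    exact ⟨m, hm.1, hm.2.1, Or.inr hm.2.2⟩

theorem exists_notMem_line {l : Set X} (hl : l ∈ 𝒜.lines) : ∃ P ∈ 𝒜.points, P ∉ l := by
  obtain ⟨P, hP, Q, hQ, R, hR, h⟩ := 𝒜.noncollinear
  by_contra! hcon
  exact h l hl ⟨hcon P hP, hcon Q hQ, hcon R hR⟩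

/-- Nontriviality excludes the single point without lines, which satisfies all the axioms of
`AffinePlane`. -/
theorem exists_line_through (h𝒜 : 𝒜.points.Nontrivial) {P Q : X} (hP : P ∈ 𝒜.points)
    (hQ : Q ∈ 𝒜.points) : ∃ l ∈ 𝒜.lines, P ∈ l ∧ Q ∈ l := by
  by_cases h : P = Q
  · subst h
    obtain ⟨R, hR, hne⟩ := h𝒜.exists_ne P
    obtain ⟨l, hl, h1, -⟩ := (𝒜.line_through P hP R hR hne.symm).exists
    exact ⟨l, hl, h1, h1⟩
  · exact (𝒜.line_through P hP Q hQ h).exists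

theorem exists_line_direction (u : 𝒜.Direction) {P : X} (hP : P ∈ 𝒜.points) :
    ∃ m, ∃ hm : m ∈ 𝒜.lines, 𝒜.direction m hm = u ∧ P ∈ m := by
  obtain ⟨l, hl, rfl⟩ := u.exists_rep
  obtain ⟨m, hm, hPm, h⟩ := exists_parallel_through hl hP
  exact ⟨m, hm, direction_eq_iff.2 h.symm, hPm⟩

theorem eq_of_direction_eq {l m : Set X} {hl : l ∈ 𝒜.lines} {hm : m ∈ 𝒜.lines}
    (h : 𝒜.direction l hl = 𝒜.direction m hm) {P : X} (h1 : P ∈ l) (h2 : P ∈ m) : l = m :=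
  (direction_eq_iff.1 h).eq_of_mem h1 h2

/-- The points and directions of an affine plane. -/
def directedPlane (𝒜 : AffinePlane X) (h𝒜 : 𝒜.points.Nontrivial) :
    DirectedPlane 𝒜.points 𝒜.Direction where
  rel u A B := ∃ m, ∃ hm : m ∈ 𝒜.lines, 𝒜.direction m hm = u ∧ (A : X) ∈ m ∧ (B : X) ∈ m
  refl u A := by
    obtain ⟨m, hm, h, hA⟩ := exists_line_direction u A.2
    exact ⟨m, hm, h, hA, hA⟩
  symm := by
    rintro u A B ⟨m, hm, h, hA, hB⟩
    exact ⟨m, hm, h, hB, hA⟩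
  trans := by
    rintro u A B C ⟨m, hm, h, hA, hB⟩ ⟨n, hn, h', hB', hC⟩
    obtain rfl := eq_of_direction_eq (h.trans h'.symm) hB hB'
    exact ⟨m, hm, h, hA, hC⟩
  exists_dir A B := by
    obtain ⟨m, hm, hA, hB⟩ := exists_line_through h𝒜 A.2 B.2
    exact ⟨_, m, hm, rfl, hA, hB⟩
  eq_of_rel := by
    rintro u v A B huv ⟨m, hm, rfl, hA, hB⟩ ⟨n, hn, rfl, hA', hB'⟩
    by_contra hne
    obtain rfl := line_eq hm hn (fun h => hne (Subtype.ext h)) hA hB hA' hB'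
    exact huv rfl
  meet := by
    intro u v A B huv
    obtain ⟨m, hm, h, hA⟩ := exists_line_direction u A.2
    obtain ⟨n, hn, h', hB⟩ := exists_line_direction v B.2
    have : (m ∩ n).Nonempty := by
      rw [Set.nonempty_iff_ne_empty]
      intro h0
      exact huv (h ▸ h' ▸ direction_eq_iff.2 (Or.inr h0))
    obtain ⟨P, hPm, hPn⟩ := this
    exact ⟨⟨P, 𝒜.line_subset m hm hPm⟩, ⟨m, hm, h, hA, hPm⟩, ⟨n, hn, h', hB, hPn⟩⟩
  exists_off := by
    intro u A
    obtain ⟨m, hm, h, hA⟩ := exists_line_direction u A.2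
    obtain ⟨B, hB, hBm⟩ := exists_notMem_line hm
    refine ⟨⟨B, hB⟩, ?_⟩
    rintro ⟨n, hn, h', hA', hB'⟩
    exact hBm (eq_of_direction_eq (h.trans h'.symm) hA hA' ▸ hB')

variable {h𝒜 : 𝒜.points.Nontrivial}

theorem rel_direction_iff {l : Set X} (hl : l ∈ 𝒜.lines) {A B : 𝒜.points} (hA : (A : X) ∈ l) :
    (𝒜.directedPlane h𝒜).rel (𝒜.direction l hl) A B ↔ (B : X) ∈ l := by
  constructor
  · rintro ⟨m, hm, h, hA', hB⟩
    exact eq_of_direction_eq h hA' hA ▸ hB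
  · exact fun hB => ⟨l, hl, rfl, hA, hB⟩

theorem lineParallel_iff (P Q R S : 𝒜.points) : 𝒜.LineParallel P Q R S ↔
    ∃ u, (𝒜.directedPlane h𝒜).rel u P Q ∧ (𝒜.directedPlane h𝒜).rel u R S := by
  constructor
  · rintro ⟨l, hl, m, hm, h1, h2, h3, h4, h⟩
    exact ⟨_, ⟨l, hl, rfl, h1, h2⟩, ⟨m, hm, direction_eq_iff.2 h.symm, h3, h4⟩⟩
  · rintro ⟨u, ⟨l, hl, h, h1, h2⟩, ⟨m, hm, h', h3, h4⟩⟩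
    exact ⟨l, hl, m, hm, h1, h2, h3, h4, direction_eq_iff.1 (h.trans h'.symm)⟩

theorem LineParallel.mem_points {P Q R S : X} (h : 𝒜.LineParallel P Q R S) : S ∈ 𝒜.points := by
  obtain ⟨-, -, m, hm, -, -, -, h4, -⟩ := h
  exact 𝒜.line_subset m hm h4

theorem IsDesargues.parallelDesargues (hD : 𝒜.IsDesargues) :
    (𝒜.directedPlane h𝒜).ParallelDesargues := by
  rintro u A A' B B' C C' v w x ⟨k, hk, hku, hA, hA'⟩ ⟨l, hl, hlu, hB, hB'⟩ ⟨m, hm, hmu, hC, hC'⟩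
    hAB hBC hAC e1 e2 e3 e4 e5
  have h := hD k hk l hl m hm
    (by rintro rfl; exact hAB ⟨k, hk, hku, hA, hB⟩)
    (by rintro rfl; exact hBC ⟨l, hl, hlu, hB, hC⟩)
    (by rintro rfl; exact hAC ⟨k, hk, hku, hA, hC⟩) A hA A' hA' B hB B' hB' C hC C' hC'
    (Or.inl ⟨direction_eq_iff.1 (hku.trans hlu.symm), direction_eq_iff.1 (hlu.trans hmu.symm),
      direction_eq_iff.1 (hku.trans hmu.symm)⟩)
    ((lineParallel_iff A B A' B').2 ⟨v, e1, e2⟩) ((lineParallel_iff B C B' C').2 ⟨w, e3, e4⟩)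
  obtain ⟨y, h1, h2⟩ := (lineParallel_iff (h𝒜 := h𝒜) A C A' C').1 h
  have hne : A ≠ C := by rintro rfl; exact hAC ⟨k, hk, hku, hA, hA⟩
  rwa [DirectedPlane.dir_unique hne e5 h1]

theorem IsDesargues.centralDesargues (hD : 𝒜.IsDesargues) :
    (𝒜.directedPlane h𝒜).CentralDesargues := by
  rintro V a b c A A' B B' C C' v w x hab hbc hac ⟨k, hk, rfl, hVk, hA⟩ hA'
    ⟨l, hl, rfl, hVl, hB⟩ hB' ⟨m, hm, rfl, hVm, hC⟩ hC' a1 a2 b1 b2 c1 c2 e1 e2 e3 e4 e5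
  rw [rel_direction_iff hk hVk] at hA'
  rw [rel_direction_iff hl hVl] at hB'
  rw [rel_direction_iff hm hVm] at hC'
  have hne : A ≠ C := by
    rintro rfl
    exact hac (DirectedPlane.dir_unique a1.symm ((rel_direction_iff hk hVk).2 hA)
      ((rel_direction_iff (h𝒜 := h𝒜) hm hVm).2 hC))
  have coe : ∀ {P Q : 𝒜.points}, P ≠ Q → (P : X) ≠ Q := fun h h' => h (Subtype.ext h')
  have h := hD k hk l hl m hm (by rintro rfl; exact hab rfl) (by rintro rfl; exact hbc rfl)
    (by rintro rfl; exact hac rfl) A hA A' hA' B hB B' hB' C hC C' hC'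
    (Or.inr ⟨V, hVk, hVl, hVm, coe a1, coe a2, coe b1, coe b2, coe c1, coe c2⟩)
    ((lineParallel_iff A B A' B').2 ⟨v, e1, e2⟩) ((lineParallel_iff B C B' C').2 ⟨w, e3, e4⟩)
  obtain ⟨y, h1, h2⟩ := (lineParallel_iff (h𝒜 := h𝒜) A C A' C').1 h
  rwa [DirectedPlane.dir_unique hne e5 h1]

theorem IsOrdered.projectionsPreserve {btw : X → X → X → Prop} (h : 𝒜.IsOrdered btw) :
    (𝒜.directedPlane h𝒜).ProjectionsPreserve (fun A B C => btw A B C) := by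
  classical
  intro u v d A B C A' B' C' hdu hdv hAB hAC hAB' hAC' hA hB hC hb
  obtain ⟨k, hk, rfl, hAk⟩ := exists_line_direction u A.2
  obtain ⟨l, hl, rfl, hAl⟩ := exists_line_direction v A'.2
  obtain ⟨n, hn, rfl⟩ := d.exists_rep
  have hBk := (rel_direction_iff hk hAk).1 hAB
  have hCk := (rel_direction_iff hk hAk).1 hAC
  have hBl := (rel_direction_iff hl hAl).1 hAB'
  have hCl := (rel_direction_iff hl hAl).1 hAC'
  have hex : ∀ P, ∃ Q, ∀ hP : P ∈ k, ∃ hQ : Q ∈ l, (𝒜.directedPlane h𝒜).rel (𝒜.direction n hn)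
      ⟨P, 𝒜.line_subset k hk hP⟩ ⟨Q, 𝒜.line_subset l hl hQ⟩ := by
    intro P
    by_cases hP : P ∈ k
    · obtain ⟨Q, h1, h2⟩ := (𝒜.directedPlane h𝒜).meet ⟨P, 𝒜.line_subset k hk hP⟩ A' hdv
      exact ⟨Q, fun _ => ⟨(rel_direction_iff hl hAl).1 h2, h1⟩⟩
    · exact ⟨P, fun h => absurd h hP⟩
  choose f hf hf' using hex
  have hval : ∀ {P P' : 𝒜.points}, (P : X) ∈ k → (P' : X) ∈ l →
      (𝒜.directedPlane h𝒜).rel (𝒜.direction n hn) P P' → f P = P' := fun {P P'} hP hP' hd =>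
    congrArg Subtype.val (DirectedPlane.meet_unique hdv (hf' P hP) hd
      ((rel_direction_iff hl hAl).2 (hf P hP)) ((rel_direction_iff hl hAl).2 hP'))
  have hproj : 𝒜.IsParallelProjection k l f := by
    refine ⟨n, hn, fun h => hdu (direction_eq_iff.2 h), fun h => hdv (direction_eq_iff.2 h),
      fun P hP => ⟨hf P hP, ?_⟩⟩
    obtain ⟨m, hm, h1, h2, h3⟩ := hf' P hP
    exact ⟨m, hm, h2, h3, (direction_eq_iff.1 h1).symm⟩
  rw [← hval hAk hAl hA, ← hval hBk hBl hB, ← hval hCk hCl hC]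
  -- A reversing projection also preserves betweenness, since betweenness is symmetric in its outer
  -- points.
  rcases h.projection k hk l hl f hproj with h' | h'
  · exact h' A hAk B hBk C hCk hb
  · exact (h.line l hl).symm _ (hf _ hCk) _ (hf _ hBk) _ (hf _ hAk) (h' A hAk B hBk C hCk hb)

/-! ### The two constructions and the ordered skew field over the line -/

/-- The skew fields constructed over `l` are those described by translations and dilatations. -/
theorem isConstructedSkewField_iff {l : Set X} (hl : l ∈ 𝒜.lines) {O I : l} (hOI : O ≠ I)
    (hex : ∀ A A', ∃ f, (𝒜.directedPlane h𝒜).IsTranslation f ∧ f A = A')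
    (hC : (𝒜.directedPlane h𝒜).CentralDesargues) (K : DivisionRing l) :
    𝒜.IsConstructedSkewField O I K ↔ (𝒜.directedPlane h𝒜).IsCoordinateField
      (fun x : l => (⟨x, 𝒜.line_subset l hl x.2⟩ : 𝒜.points))
      ⟨O, 𝒜.line_subset l hl O.2⟩ ⟨I, 𝒜.line_subset l hl I.2⟩ K := by
  set S := 𝒜.directedPlane h𝒜
  set ι : l → 𝒜.points := fun x => ⟨x, 𝒜.line_subset l hl x.2⟩ with hι
  set e := 𝒜.direction l hl
  have inj : Function.Injective ι := fun x y h => Subtype.ext (Subtype.ext_iff.1 h :)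
  have he : ∀ x y : l, S.rel e (ι x) (ι y) := fun x y => (rel_direction_iff hl x.2).2 y.2
  have hoff : ∀ {B : 𝒜.points} {x : l}, S.rel e (ι x) B ↔ (B : X) ∈ l := fun {B x} =>
    rel_direction_iff hl x.2
  have hO' : ι O ≠ ι I := inj.ne hOI
  have hne : ∀ {B : 𝒜.points} {x : l}, (B : X) ∉ l → ι x ≠ B := by
    rintro _ x hB rfl; exact hB x.2
  have hedir : ∀ {B : 𝒜.points} {x : l} {w}, (B : X) ∉ l → S.rel w (ι x) B → w ≠ e := by
    rintro B x w hB hw rfl; exact hB (hoff.1 hw)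
  change _ ↔ S.IsCoordinateField ι (ι O) (ι I) K
  constructor
  -- A single auxiliary point suffices here: the lines of the constructions determine `D` and `E` as
  -- images of `B`, and then the end points as images of `C`.
  · intro h
    obtain ⟨B, hB⟩ := S.exists_off e (ι O)
    rw [hoff] at hB
    obtain ⟨b, hb⟩ := S.exists_dir (ι O) B
    refine ⟨congrArg ι h.zero_eq, congrArg ι h.one_eq, ?_, ?_⟩
    · intro A C f hf hfO
      obtain ⟨D, h1, h2, h3, -⟩ := h.add_eq A C B B.2 hB
      obtain ⟨D, rfl⟩ : ∃ D' : 𝒜.points, (D' : X) = D := ⟨⟨D, h1.mem_points⟩, rfl⟩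
      obtain ⟨u, h1, h1'⟩ := (lineParallel_iff (h𝒜 := h𝒜) (ι O) (ι I) B D).1 h1
      obtain ⟨v, h2, h2'⟩ := (lineParallel_iff (h𝒜 := h𝒜) (ι O) B (ι A) D).1 h2
      obtain ⟨w, k3, k3'⟩ := (lineParallel_iff (h𝒜 := h𝒜) (ι C) B D (ι (K.add A C))).1 h3
      obtain rfl := DirectedPlane.dir_unique hO' (he O I) h1
      obtain rfl := DirectedPlane.dir_unique (hne hB) hb h2
      have hfe := hf.rel_all (hfO.symm ▸ he O A)
      have h4 := hf.1 b _ _ hb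
      rw [hfO] at h4
      have hD : D = f B := DirectedPlane.meet_unique (hedir hB hb) h2' h4 h1' (hfe B)
      subst hD
      exact DirectedPlane.meet_unique (hedir hB k3) k3' (S.symm (hf.1 w _ _ k3))
        (he C _) (hfe (ι C))
    · intro A C f hf hfO hfI
      obtain ⟨E, h1, ⟨n, hn, h2, h3, h4⟩, h5, -⟩ := h.mul_eq A C B B.2 hB
      obtain ⟨E, rfl⟩ : ∃ E' : 𝒜.points, (E' : X) = E := ⟨⟨E, h1.mem_points⟩, rfl⟩
      obtain ⟨v, h1, h1'⟩ := (lineParallel_iff (h𝒜 := h𝒜) (ι I) B (ι A) E).1 h1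
      obtain ⟨w, k5, k5'⟩ := (lineParallel_iff (h𝒜 := h𝒜) B (ι C) E (ι (K.mul A C))).1 h5
      have hOB : S.rel (𝒜.direction n hn) (ι O) B := ⟨n, hn, rfl, h2, h3⟩
      have hOE : S.rel (𝒜.direction n hn) (ι O) E := ⟨n, hn, rfl, h2, h4⟩
      obtain rfl := DirectedPlane.dir_unique (hne hB) hb hOB
      have hvb : v ≠ 𝒜.direction n hn := by
        rintro rfl
        exact hedir hB hb (DirectedPlane.dir_unique hO' (S.trans hb (S.symm h1)) (he O I))
      have h6 := hf _ _ _ hb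
      have h7 := hf _ _ _ h1
      rw [hfO] at h6
      rw [hfI] at h7
      have hE : E = f B := DirectedPlane.meet_unique hvb h1' h7 hOE h6
      subst hE
      have h8 := hf e _ _ (he O C)
      rw [hfO] at h8
      exact DirectedPlane.meet_unique (hedir hB (S.symm k5)) k5' (hf _ _ _ k5)
        (he O _) h8
  -- Here `B` is arbitrary, and its image under the translation or dilatation serves as the
  -- intermediate point.
  · intro h
    refine ⟨inj h.zero_eq, inj h.one_eq, ?_, ?_⟩
    · intro A C B hB hBl
      lift B to 𝒜.points using hB
      obtain ⟨f, hf, hfO⟩ := hex (ι O) (ι A)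
      have hfe := hf.rel_all (hfO.symm ▸ he O A)
      obtain ⟨b, hb⟩ := S.exists_dir (ι O) B
      obtain ⟨w, hw⟩ := S.exists_dir (ι C) B
      refine ⟨f B, (lineParallel_iff (h𝒜 := h𝒜) (ι O) (ι I) B (f B)).2 ⟨e, he O I, hfe B⟩,
        (lineParallel_iff (h𝒜 := h𝒜) (ι O) B (ι A) (f B)).2 ⟨b, hb, hfO ▸ hf.1 b _ _ hb⟩,
        (lineParallel_iff (h𝒜 := h𝒜) (ι C) B (f B) (ι (K.add A C))).2 ⟨w, hw, ?_⟩,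
        (K.add A C).2⟩
      rw [h.add_eq hf hfO]
      exact S.symm (hf.1 w _ _ hw)
    · intro A C B hB hBl
      lift B to 𝒜.points using hB
      obtain ⟨f, hf, hfO, hfI⟩ :=
        DirectedPlane.exists_homothety hC hO'.symm (he O I) (he O A)
      obtain ⟨b, hb⟩ := S.exists_dir (ι O) B
      obtain ⟨v, hv⟩ := S.exists_dir (ι I) B
      obtain ⟨w, hw⟩ := S.exists_dir B (ι C)
      have hb' := hf b _ _ hb
      rw [hfO] at hb'
      obtain ⟨n, hn, rfl, h1, h2⟩ := hb
      refine ⟨f B, (lineParallel_iff (h𝒜 := h𝒜) (ι I) B (ι A) (f B)).2 ⟨v, hv, hfI ▸ hf v _ _ hv⟩,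
        ⟨n, hn, h1, h2, (rel_direction_iff hn h1).1 hb'⟩,
        (lineParallel_iff (h𝒜 := h𝒜) B (ι C) (f B) (ι (K.mul A C))).2 ⟨w, hw, ?_⟩,
        (K.mul A C).2⟩
      rw [h.mul_eq hf hfO hfI]
      exact hf w _ _ hw

theorem hasThreeParallels (hcard : 4 < 𝒜.points.encard) :
    (𝒜.directedPlane h𝒜).HasThreeParallels := by
  have h5 : (5 : ℕ∞) ≤ 𝒜.points.encard := Order.add_one_le_of_lt hcard
  obtain ⟨t, ht, htc⟩ := Set.exists_subset_encard_eq h5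
  have hfin : t.Finite := Set.finite_of_encard_eq_coe (k := 5) (by exact_mod_cast htc)
  have := hfin.to_subtype
  have hc : Nat.card t = 5 := by
    rw [Nat.card_coe_set_eq, Set.ncard, htc]; rfl
  let g : Fin 5 ≃ t := (Finite.equivFinOfCardEq hc).symm
  exact DirectedPlane.hasThreeParallels_of_injective (fun i => ⟨g i, ht (g i).2⟩)
    fun i j h => g.injective (Subtype.ext (Subtype.ext_iff.1 h :))

end AffinePlane

theorem mainTheorem2 (𝒜 : AffinePlane (EuclideanSpace ℝ (Fin 2)))
    (hDesargues : 𝒜.IsDesargues)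
    (btw : EuclideanSpace ℝ (Fin 2) → EuclideanSpace ℝ (Fin 2) → EuclideanSpace ℝ (Fin 2) → Prop)
    (hOrdered : 𝒜.IsOrdered btw)
    (hcard : 4 < 𝒜.points.encard)
    (l : Set (EuclideanSpace ℝ (Fin 2))) (hl : l ∈ 𝒜.lines)
    (O I : l) (hOI : O ≠ I) :
    (∃ K : DivisionRing l, 𝒜.IsConstructedSkewField O I K) ∧
    ∀ K : DivisionRing l, 𝒜.IsConstructedSkewField O I K →
      IsOrderedSkewField K (AffinePlane.negSide btw O I) (AffinePlane.posSide btw O I) ∧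
      (Finite l →
        IsFiniteOrderedSkewField K (AffinePlane.negSide btw O I) (AffinePlane.posSide btw O I)) := by
  have hlp := 𝒜.line_subset l hl
  have h𝒜 : 𝒜.points.Nontrivial :=
    ⟨O, hlp O.2, I, hlp I.2, fun h => hOI (Subtype.ext h)⟩
  let S := 𝒜.directedPlane h𝒜
  have hC : S.CentralDesargues := hDesargues.centralDesargues
  have hP : S.ParallelDesargues := hDesargues.parallelDesargues
  have h3 : S.HasThreeParallels := AffinePlane.hasThreeParallels hcard
  have hex := DirectedPlane.exists_translation hP h3
  have hiff := AffinePlane.isConstructedSkewField_iff hl hOI hex hC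
  let ι : l → 𝒜.points := fun x => ⟨x, hlp x.2⟩
  let e := 𝒜.direction l hl
  have inj : Function.Injective ι := fun x y h => Subtype.ext (Subtype.ext_iff.1 h :)
  have hrange : ∀ P, S.rel e (ι O) P ↔ ∃ x, ι x = P := fun P =>
    (AffinePlane.rel_direction_iff hl O.2).trans
      ⟨fun h => ⟨⟨P, h⟩, rfl⟩, by rintro ⟨x, rfl⟩; exact x.2⟩
  have hmem : ∀ x, S.rel e (ι O) (ι x) := fun x => (hrange _).2 ⟨x, rfl⟩
  refine ⟨?_, fun K hK => ?_⟩
  · obtain ⟨K, hK⟩ :=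
      DirectedPlane.exists_coordinateField hP hC h3 inj hrange (inj.ne hOI) (hmem I)
    exact ⟨K, (hiff K).2 hK⟩
  have hK' : S.IsCoordinateField ι (ι O) (ι I) K := (hiff K).1 hK
  have hbtw : S.ProjectionsPreserve (fun A B C => btw A B C) := hOrdered.projectionsPreserve
  have hline := hOrdered.line l hl
  have hO : O = 0 := hK.zero_eq.symm
  have hI : I = 1 := hK.one_eq.symm
  have hunit : AffinePlane.IsOrderedLine (fun x y z : l => btw x y z) Set.univ := by
    refine ⟨fun A _ B _ C _ h => ?_, fun A _ B _ C _ => hline.symm A A.2 B B.2 C C.2,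
      fun A _ B _ C _ h1 h2 h3 => hline.exactly_one A A.2 B B.2 C C.2
        (Subtype.coe_ne_coe.2 h1) (Subtype.coe_ne_coe.2 h2) (Subtype.coe_ne_coe.2 h3),
      fun A _ B _ C _ D _ => hline.extend A A.2 B B.2 C C.2 D D.2,
      fun A _ B _ C _ D _ h => hline.same_side A A.2 B B.2 C C.2 D D.2 (Subtype.coe_ne_coe.2 h)⟩
    obtain ⟨h1, h2, h3⟩ := hline.distinct A A.2 B B.2 C C.2 h
    exact ⟨Subtype.coe_ne_coe.1 h1, Subtype.coe_ne_coe.1 h2, Subtype.coe_ne_coe.1 h3⟩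
  -- A line in a direction other than that of `l` that passes through neither `O` nor `I` meets `l`
  -- in a third point.
  obtain ⟨r, hr0, hr1⟩ : ∃ r : l, r ≠ 0 ∧ r ≠ 1 := by
    obtain ⟨u, hu⟩ := S.exists_dir_ne e (ι O)
    obtain ⟨Q, hQO, hQI⟩ := h3 u (ι O) (ι I)
    obtain ⟨P, h1, h2⟩ := S.meet (ι O) Q hu.symm
    obtain ⟨r, rfl⟩ := (hrange P).1 h1
    refine ⟨r, ?_, ?_⟩
    · rintro rfl; rw [← hO] at h2; exact hQO (S.symm h2)
    · rintro rfl; rw [← hI] at h2; exact hQI (S.symm h2)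
  have hord := hunit.isOrderedSkewField
    (fun A X Y Z h => hK'.btw_add hbtw hex hmem A X Y Z h)
    (fun D X Y Z hD h => hK'.btw_mul hbtw hC inj hmem (inj.ne hOI) (hmem I) D X Y Z hD h)
    hr0 hr1
  rw [← hO, ← hI] at hord
  exact ⟨hord, fun hfin => ⟨hfin, hord⟩⟩
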